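/- Let $p$ be a prime, $\mathbb N_0=\{0,1,2,\ldots\}$, and let $E$ be a Hausdorff, sequentially complete, locally convex topological vector space over $\mathbb Q_p$ (locally convex: the open $\mathbb Z_p$-submodules of $E$ form a basis of $0$-neighbourhoods). Let $n_1,\ldots,n_\ell\in\mathbb N$, $n=n_1+\cdots+n_\ell$ and $\alpha\in(\mathbb N_0\cup\{\infty\})^\ell$. *Differentiability.* A set $V\subseteq\mathbb Q_p^n$ is cartesian if $V=V_1\times\cdots\times V_n$ with sets $V_i\subseteq\mathbb Q_p$ without isolated points. For $\beta\in\mathbb N_0^n$ let $V^{<\beta>}$ be the set of all $x=(x^{(i)}_j)_{1\le i\le n,\,0\le j\le\beta_i}$ with $(x^{(1)}_{j_1},\ldots,x^{(n)}_{j_n})\in V$ for all choices of $j_i\in\{0,\ldots,\beta_i\}$, and $V^{>\beta<}$ the subset of those $x$ such that for each $i$ the entries $x^{(i)}_0,\ldots,x^{(i)}_{\beta_i}$ are pairwise distinct. For $f\colon V\to E$ define $f^{>\beta<}\colon V^{>\beta<}\to E$ by $$f^{>\beta<}(x)=\sum_{j_1=0}^{\beta_1}\cdots\sum_{j_n=0}^{\beta_n}\Big(\prod_{i=1}^n\prod_{k\ne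 j_i}\frac1{x^{(i)}_{j_i}-x^{(i)}_k}\Big)f(x^{(1)}_{j_1},\ldots,x^{(n)}_{j_n}).$$ A map $f\colon\mathbb Z_p^n\to E$ is $C^\gamma$, for $\gamma\in\mathbb N_0^n$, if for all $\beta\le\gamma$ and all relatively open cartesian $V\subseteq\mathbb Z_p^n$ the map $(f|_V)^{>\beta<}$ has a (necessarily unique) continuous extension $(f|_V)^{<\beta>}\colon V^{<\beta>}\to E$. The space $C^\gamma(\mathbb Z_p^n,E)$ carries the initial topology with respect to the maps $f\mapsto(f|_V)^{<\beta>}\in C(V^{<\beta>},E)$ (compact-open topology). Let $N_\alpha$ be the set of all $\beta=(\beta_1,\ldots,\beta_\ell)\in\mathbb N_0^{n_1}\times\cdots\times\mathbb N_0^{n_\ell}=\mathbb N_0^n$ with $|\beta_j|\le\alpha_j$ for all $j$. A map $f\colon\mathbb Z_p^n\to E$ is $C^\alpha$ if it is $C^\beta$ for all $\beta\in N_\alpha$; the space $C^\alpha(\mathbb Z_p^n,E)$ of these maps carries the initial topology with respect to the inclusions into $C^\beta(\mathbb Z_p^n,E)$, $\beta\in N_\alpha$. For $r\in\mathbb N_0$,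 $f$ is $C^r$ if it is $C^\gamma$ for all $\gamma\in\mathbb N_0^n$ with $|\gamma|\le r$. *Mahler coefficients and weighted spaces.* For $f\colon\mathbb Z_p^n\to E$ and $\nu\in\mathbb N_0^n$ let $a_\nu(f)=\sum_{\mu\le\nu}(-1)^{|\nu|-|\mu|}\binom\nu\mu f(\mu)$, where $\binom{\nu}{\mu}=\prod_i\binom{\nu_i}{\mu_i}$. For $\beta\in\mathbb N_0^n$ let $w_\beta(\nu)=\nu^\beta=\nu_1^{\beta_1}\cdots\nu_n^{\beta_n}$, with $0^0=1$. For a non-empty set $\mathcal W$ of functions $w\colon\mathbb N_0^n\to[0,\infty[$, let $c_0(\mathbb N_0^n,\mathcal W,E)$ be the space of all $b\colon\mathbb N_0^n\to E$ such that for all $w\in\mathcal W$, all continuous ultrametric seminorms $q$ on $E$ and all $\varepsilon>0$ one has $w(\nu)q(b(\nu))<\varepsilon$ for all but finitely many $\nu$; it carries the locally convex topology defined by the seminorms $\|b\|_{w,q}=\sup_\nu w(\nu)q(b(\nu))$. Let $N'_\alpha$ be the set of all $\beta=(\beta_1,\ldots,\beta_\ell)\in N_\alpha$ such that each block $\beta_j\in\mathbb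 N_0^{n_j}$ has at most one non-zero component, and $\mathcal W'_\alpha=\{w_\beta:\beta\in N'_\alpha\}$. Then: (a) A continuous function $f\colon\mathbb Z_p^n\to E$ is $C^\alpha$ if and only if $q(a_\nu(f))\,\nu^\beta\to0$ as $|\nu|\to\infty$, for each $\beta\in N'_\alpha$ and each continuous ultrametric seminorm $q$ on $E$. (b) The map $C^\alpha(\mathbb Z_p^n,E)\to c_0(\mathbb N_0^n,\mathcal W'_\alpha,E)$, $f\mapsto(a_\nu(f))_{\nu\in\mathbb N_0^n}$, is an isomorphism of topological vector spaces. (c) For every $n\in\mathbb N$ and $r\in\mathbb N_0$, a continuous function $f\colon\mathbb Z_p^n\to E$ is $C^r$ if and only if $q(a_\nu(f))\,|\nu|^r\to0$ as $|\nu|\to\infty$, for each continuous ultrametric seminorm $q$ on $E$. -/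

import Mathlib

open Set Filter Topology
open scoped NNReal

noncomputable section

/-! ### Cartesian sets and partial difference quotients -/

section DifferenceQuotients

variable {ι K E : Type*} [Fintype ι] [DecidableEq ι] [Field K]

/-- `U ⊆ K^ι` is cartesian: a product of subsets of `K` without isolated points. -/
def IsCartesian [TopologicalSpace K] (U : Set (ι → K)) : Prop :=
  ∃ S : ι → Set K, (∀ i, Preperfect (S i)) ∧ U = Set.pi Set.univ S

/-- `V` is a relatively open subset of `U` which is cartesian. -/
def IsOpenCartesianIn [TopologicalSpace K] (V U : Set (ι → K)) : Prop :=
  V ⊆ U ∧ IsOpen ((↑) ⁻¹' V : Set U) ∧ IsCartesian V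

/-- The set `U^{<β>}` of all `x = (x^{(i)}_j)`, with `i ∈ ι` and `0 ≤ j ≤ β i`, such that
`(x^{(i)}_{j_i})_i ∈ U` for all choices of the indices `j_i`. -/
def extDom (U : Set (ι → K)) (β : ι → ℕ) : Set (∀ i, Fin (β i + 1) → K) :=
  {x | ∀ j : ∀ i, Fin (β i + 1), (fun i => x i (j i)) ∈ U}

/-- The subset `U^{>β<}` of `U^{<β>}`: the entries of each `x^{(i)}` are pairwise distinct. -/
def diffDom (U : Set (ι → K)) (β : ι → ℕ) : Set (extDom U β) :=
  {x | ∀ i, Function.Injective (x.1 i)}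

variable [AddCommGroup E] [Module K E]

/-- The iterated partial difference quotient `f^{>β<} : U^{>β<} → E`. -/
def diffQuot {U : Set (ι → K)} (f : U → E) (β : ι → ℕ) (x : diffDom U β) : E :=
  ∑ j : ∀ i, Fin (β i + 1),
    (∏ i, ∏ k ∈ Finset.univ.erase (j i), (x.1.1 i (j i) - x.1.1 i k)⁻¹) •
      f ⟨fun i => x.1.1 i (j i), x.1.2 j⟩

lemma diffQuot_add {U : Set (ι → K)} (f g : U → E) (β : ι → ℕ) (x : diffDom U β) :
    diffQuot (f + g) β x = diffQuot f β x + diffQuot g β x := by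
  simp [diffQuot, smul_add, Finset.sum_add_distrib]

lemma diffQuot_smul {U : Set (ι → K)} (c : K) (f : U → E) (β : ι → ℕ) (x : diffDom U β) :
    diffQuot (c • f) β x = c • diffQuot f β x := by
  simp only [diffQuot, Finset.smul_sum, Pi.smul_apply]
  exact Finset.sum_congr rfl fun j _ => smul_comm _ _ _

lemma diffQuot_zero {U : Set (ι → K)} (β : ι → ℕ) (x : diffDom U β) :
    diffQuot (0 : U → E) β x = 0 := by
  simp [diffQuot]

variable [TopologicalSpace K] [TopologicalSpace E]

/-- `g : U^{<β>} → E` is a continuous extension of `f^{>β<}`. -/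
def IsDiffExt {U : Set (ι → K)} (f : U → E) (β : ι → ℕ) (g : C(extDom U β, E)) : Prop :=
  ∀ x : diffDom U β, g x.1 = diffQuot f β x

/-- `f : U → E` is `C^α`, for `U ⊆ K^ι` locally cartesian and `α ∈ (ℕ₀ ∪ {∞})^ι`: for each
relatively open cartesian `V ⊆ U` and `β ≤ α`, the map `(f|_V)^{>β<}` extends continuously to
`V^{<β>}`. If `U` is cartesian, this is equivalent to the condition for `V = U` alone. -/
def IsCAlpha (U : Set (ι → K)) (α : ι → ℕ∞) (f : U → E) : Prop :=
  ∀ (V : Set (ι → K)) (hV : IsOpenCartesianIn V U) (β : ι → ℕ), (∀ i, (β i : ℕ∞) ≤ α i) →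
    ∃ g : C(extDom V β, E), IsDiffExt (f ∘ Set.inclusion hV.1) β g

/-- `f` is `C^r`, for `r ∈ ℕ₀ ∪ {∞}`: it is `C^α` for all `α ∈ ℕ₀^ι` with `|α| ≤ r`. -/
def IsCr (U : Set (ι → K)) (r : ℕ∞) (f : U → E) : Prop :=
  ∀ α : ι → ℕ, ((∑ i, α i : ℕ) : ℕ∞) ≤ r → IsCAlpha U (fun i => (α i : ℕ∞)) f

end DifferenceQuotients

/-! ### The space of `C^α`-maps and the compact-open `C^α`-topology -/

section FunctionSpace

variable {ι K : Type*} [Fintype ι] [DecidableEq ι] [Field K] [TopologicalSpace K]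
variable (U : Set (ι → K)) (α : ι → ℕ∞)
variable (E : Type*) [AddCommGroup E] [Module K E] [TopologicalSpace E]
  [IsTopologicalAddGroup E] [ContinuousSMul K E]

/-- The vector space of `C^α`-maps as a subspace of the space of all maps `U → E`. -/
def cAlphaSubmodule : Submodule K (U → E) where
  carrier := {f | IsCAlpha U α f}
  add_mem' := by
    intro f g hf hg V hV β hβ
    obtain ⟨F, hF⟩ := hf V hV β hβ
    obtain ⟨G, hG⟩ := hg V hV β hβ
    refine ⟨F + G, fun x => ?_⟩
    have := diffQuot_add (f ∘ Set.inclusion hV.1) (g ∘ Set.inclusion hV.1) β x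
    rw [ContinuousMap.add_apply, hF x, hG x, ← this]
    rfl
  zero_mem' := fun V hV β _ => ⟨0, fun x => (diffQuot_zero β x).symm⟩
  smul_mem' := by
    intro c f hf V hV β hβ
    obtain ⟨F, hF⟩ := hf V hV β hβ
    refine ⟨⟨fun x => c • F x, F.continuous.const_smul c⟩, fun x => ?_⟩
    have := diffQuot_smul c (f ∘ Set.inclusion hV.1) β x
    change c • F x.1 = _
    rw [hF x, ← this]
    rfl

/-- The space `C^α(U, E)`, a type of its own so as not to carry the topology of pointwise
convergence. -/
def CAlphaSpace : Type _ := cAlphaSubmodule U α E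

instance : AddCommGroup (CAlphaSpace U α E) :=
  inferInstanceAs (AddCommGroup (cAlphaSubmodule U α E))

instance : Module K (CAlphaSpace U α E) :=
  inferInstanceAs (Module K (cAlphaSubmodule U α E))

variable {U α E}

/-- The map `Δ_{β,V} : C^α(U, E) → C(V^{<β>}, E)`, `f ↦ (f|_V)^{<β>}`. For Hausdorff `E` and
Hausdorff `K`, the continuous extension is unique, as `V^{>β<}` is dense in `V^{<β>}`. -/
def CAlphaSpace.ext (V : Set (ι → K)) (hV : IsOpenCartesianIn V U) (β : ι → ℕ)
    (hβ : ∀ i, (β i : ℕ∞) ≤ α i) (f : CAlphaSpace U α E) : C(extDom V β, E) :=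
  Classical.choose (f.2 V hV β hβ)

lemma CAlphaSpace.isDiffExt_ext (V : Set (ι → K)) (hV : IsOpenCartesianIn V U) (β : ι → ℕ)
    (hβ : ∀ i, (β i : ℕ∞) ≤ α i) (f : CAlphaSpace U α E) :
    IsDiffExt (f.1 ∘ Set.inclusion hV.1) β (CAlphaSpace.ext V hV β hβ f) :=
  Classical.choose_spec (f.2 V hV β hβ)

/-- The compact-open `C^α`-topology: the initial topology with respect to the maps `Δ_{β,V}`, the
spaces `C(V^{<β>}, E)` being endowed with the compact-open topology. -/
instance : TopologicalSpace (CAlphaSpace U α E) :=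
  ⨅ (V : Set (ι → K)) (hV : IsOpenCartesianIn V U) (β : ι → ℕ) (hβ : ∀ i, (β i : ℕ∞) ≤ α i),
    TopologicalSpace.induced (CAlphaSpace.ext V hV β hβ) inferInstance

end FunctionSpace

/-! ### `C^α`-maps on subsets of `K^{n_1} × ⋯ × K^{n_ℓ}`

A point of `K^{n_1} × ⋯ × K^{n_ℓ} = K^n` is a function on `Σ j : Fin ℓ, Fin (n j)`. -/

section Blocks

variable {ℓ : ℕ}

/-- The set `N_α` of all `β = (β_1, …, β_ℓ) ∈ ℕ₀^{n_1} × ⋯ × ℕ₀^{n_ℓ}` such that `|β_j| ≤ α_j`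
for all `j`. -/
def blockIndices (n : Fin ℓ → ℕ) (α : Fin ℓ → ℕ∞) : Set ((Σ j, Fin (n j)) → ℕ) :=
  {β | ∀ j, ((∑ k, β ⟨j, k⟩ : ℕ) : ℕ∞) ≤ α j}

/-- The set `N'_α` of all `β ∈ N_α` such that each block `β_j` has at most one non-zero
component. -/
def sparseBlockIndices (n : Fin ℓ → ℕ) (α : Fin ℓ → ℕ∞) : Set ((Σ j, Fin (n j)) → ℕ) :=
  {β | β ∈ blockIndices n α ∧ ∀ j k k', β ⟨j, k⟩ ≠ 0 → β ⟨j, k'⟩ ≠ 0 → k = k'}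

variable {K : Type*} [Field K] [TopologicalSpace K]
variable {n : Fin ℓ → ℕ} (U : Set ((Σ j, Fin (n j)) → K)) (α : Fin ℓ → ℕ∞)

/-- `f` is `C^α`, for `α ∈ (ℕ₀ ∪ {∞})^ℓ`: it is `C^β` for each `β ∈ N_α`. -/
def IsCBlock {E : Type*} [AddCommGroup E] [Module K E] [TopologicalSpace E] (f : U → E) : Prop :=
  ∀ β ∈ blockIndices n α, IsCAlpha U (fun i => (β i : ℕ∞)) f

variable (E : Type*) [AddCommGroup E] [Module K E] [TopologicalSpace E]
  [IsTopologicalAddGroup E] [ContinuousSMul K E]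

/-- The vector space of `C^α`-maps, for `α ∈ (ℕ₀ ∪ {∞})^ℓ`. -/
def cBlockSubmodule : Submodule K (U → E) where
  carrier := {f | IsCBlock U α f}
  add_mem' := fun hf hg β hβ => (cAlphaSubmodule U _ E).add_mem (hf β hβ) (hg β hβ)
  zero_mem' := fun _ _ => (cAlphaSubmodule U _ E).zero_mem
  smul_mem' := fun c _ hf β hβ => (cAlphaSubmodule U _ E).smul_mem c (hf β hβ)

/-- The space `C^α(U, E)`, for `α ∈ (ℕ₀ ∪ {∞})^ℓ`. -/
def CBlockSpace : Type _ := cBlockSubmodule U α E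

instance : AddCommGroup (CBlockSpace U α E) :=
  inferInstanceAs (AddCommGroup (cBlockSubmodule U α E))

instance : Module K (CBlockSpace U α E) :=
  inferInstanceAs (Module K (cBlockSubmodule U α E))

variable {U α E}

/-- The inclusion map `ι_β : C^α(U, E) → C^β(U, E)` for `β ∈ N_α`. -/
def CBlockSpace.incl (β : (Σ j, Fin (n j)) → ℕ) (hβ : β ∈ blockIndices n α)
    (f : CBlockSpace U α E) : CAlphaSpace U (fun i => (β i : ℕ∞)) E :=
  ⟨f.1, f.2 β hβ⟩

/-- The compact-open `C^α`-topology, for `α ∈ (ℕ₀ ∪ {∞})^ℓ`: the initial topology with respect to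
the inclusion maps `ι_β`, `β ∈ N_α`. -/
instance : TopologicalSpace (CBlockSpace U α E) :=
  ⨅ (β : (Σ j, Fin (n j)) → ℕ) (hβ : β ∈ blockIndices n α),
    TopologicalSpace.induced (CBlockSpace.incl β hβ) inferInstance

end Blocks

/-! ### Locally convex spaces over ultrametric fields and weighted `c₀`-spaces -/

section WeightedSpaces

/-- Local convexity over an ultrametric field `K`: the open submodules over the valuation ring
`{c : K | ‖c‖ ≤ 1}` form a basis of neighbourhoods of `0`. -/
def IsUltraLocallyConvex (K E : Type*) [NormedField K] [AddCommGroup E] [Module K E]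
    [TopologicalSpace E] : Prop :=
  ∀ s ∈ 𝓝 (0 : E), ∃ M : AddSubgroup E, IsOpen (M : Set E) ∧
    (∀ c : K, ‖c‖ ≤ 1 → ∀ x ∈ M, c • x ∈ M) ∧ (M : Set E) ⊆ s

/-- The continuous ultrametric seminorms on `E`. -/
def ContUltraSeminorm (K E : Type*) [NormedField K] [AddCommGroup E] [Module K E]
    [TopologicalSpace E] : Type _ :=
  {q : Seminorm K E // Continuous q ∧ IsNonarchimedean q}

variable {X K : Type*} [NormedField K]
variable (W : Set (X → ℝ≥0)) (E : Type*) [AddCommGroup E] [Module K E] [TopologicalSpace E]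

variable (K) in
/-- The vector space `c₀(X, 𝒲, E)`: all `f : X → E` such that `w(x) q(f(x)) → 0` along the
complements of finite sets, for all weights `w ∈ 𝒲` and continuous ultrametric seminorms `q`. -/
def c0Submodule : Submodule K (X → E) where
  carrier := {f | ∀ w ∈ W, ∀ q : ContUltraSeminorm K E,
    Tendsto (fun x => (w x : ℝ) * q.1 (f x)) cofinite (𝓝 0)}
  add_mem' := by
    intro f g hf hg w hw q
    refine squeeze_zero (fun x => by positivity) (fun x => ?_)
      (by simpa using (hf w hw q).add (hg w hw q))
    rw [← mul_add]
    exact mul_le_mul_of_nonneg_left (map_add_le_add q.1 _ _) (w x).2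
  zero_mem' := by
    intro w hw q
    refine tendsto_const_nhds.congr fun x => ?_
    rw [Pi.zero_apply, map_zero, mul_zero]
  smul_mem' := by
    intro c f hf w hw q
    have h := (hf w hw q).const_mul ‖c‖
    rw [mul_zero] at h
    refine h.congr fun x => ?_
    rw [Pi.smul_apply, map_smul_eq_mul]
    ring

variable (K) in
/-- The space `c₀(X, 𝒲, E)`, a type of its own so as not to carry the topology of pointwise
convergence. -/
def C0Space : Type _ := c0Submodule K W E

instance : AddCommGroup (C0Space K W E) :=
  inferInstanceAs (AddCommGroup (c0Submodule K W E))

instance : Module K (C0Space K W E) :=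
  inferInstanceAs (Module K (c0Submodule K W E))

variable {W E}

lemma C0Space.bddAbove (w : W) (q : ContUltraSeminorm K E) (f : C0Space K W E) :
    BddAbove (Set.range fun x => (w.1 x : ℝ) * q.1 (f.1 x)) :=
  (f.2 w.1 w.2 q).bddAbove_range_of_cofinite

/-- The seminorm `‖f‖_{w,q} = sup {w(x) q(f(x)) : x ∈ X}` on `c₀(X, 𝒲, E)`. -/
def C0Space.seminorm (w : W) (q : ContUltraSeminorm K E) : Seminorm K (C0Space K W E) :=
  Seminorm.of (fun f => ⨆ x, (w.1 x : ℝ) * q.1 (f.1 x))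
    (by
      intro f g
      have h0 : ∀ h : C0Space K W E, 0 ≤ ⨆ x, (w.1 x : ℝ) * q.1 (h.1 x) :=
        fun h => Real.iSup_nonneg fun x => by positivity
      refine Real.iSup_le (fun x => ?_) (add_nonneg (h0 f) (h0 g))
      calc (w.1 x : ℝ) * q.1 ((f + g).1 x)
          ≤ (w.1 x : ℝ) * (q.1 (f.1 x) + q.1 (g.1 x)) :=
            mul_le_mul_of_nonneg_left (map_add_le_add q.1 (f.1 x) (g.1 x)) (w.1 x).2
        _ = (w.1 x : ℝ) * q.1 (f.1 x) + (w.1 x : ℝ) * q.1 (g.1 x) := mul_add _ _ _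
        _ ≤ _ := add_le_add (le_ciSup (C0Space.bddAbove w q f) x)
            (le_ciSup (C0Space.bddAbove w q g) x))
    (by
      intro c f
      rw [Real.mul_iSup_of_nonneg (norm_nonneg c)]
      refine iSup_congr fun x => ?_
      have : q.1 ((c • f).1 x) = ‖c‖ * q.1 (f.1 x) := map_smul_eq_mul q.1 c (f.1 x)
      rw [this]
      ring)

/-- The locally convex topology on `c₀(X, 𝒲, E)` defined by the seminorms `‖·‖_{w,q}`. -/
instance : TopologicalSpace (C0Space K W E) :=
  ⨅ (w : W) (q : ContUltraSeminorm K E),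
    (C0Space.seminorm w q).toSeminormedAddCommGroup.toUniformSpace.toTopologicalSpace

end WeightedSpaces

/-! ### Mahler coefficients -/

section Mahler

variable (p : ℕ) [Fact p.Prime]

/-- The set `ℤ_p^ι ⊆ ℚ_p^ι`. -/
def zpCube (ι : Type*) : Set (ι → ℚ_[p]) := {x | ∀ i, ‖x i‖ ≤ 1}

lemma natCast_mem_zpCube {ι : Type*} (μ : ι → ℕ) : (fun i => (μ i : ℚ_[p])) ∈ zpCube p ι :=
  fun i => by simpa using Padic.norm_int_le_one (p := p) (μ i : ℤ)

variable {p} {ι E : Type*} [Fintype ι] [DecidableEq ι] [AddCommGroup E]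

/-- The `ν`-th Mahler coefficient
`a_ν(f) = ∑_{μ ≤ ν} (-1)^{|ν| - |μ|} binom(ν, μ) f(μ)` of `f : ℤ_p^ι → E`. -/
def mahlerCoeff (f : zpCube p ι → E) (ν : ι → ℕ) : E :=
  ∑ μ ∈ Finset.Iic ν, ((-1 : ℤ) ^ (∑ i, ν i - ∑ i, μ i) * ∏ i, ((ν i).choose (μ i) : ℤ)) •
    f ⟨fun i => (μ i : ℚ_[p]), natCast_mem_zpCube p μ⟩

/-- The weight `w_β(ν) = ν^β = ∏_i ν_i^{β_i}` on `ℕ₀^ι` (with `0^0 = 1`). -/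
def monomialWeight (β ν : ι → ℕ) : ℝ≥0 := ∏ i, (ν i : ℝ≥0) ^ β i

end Mahler

end

set_option linter.unusedSectionVars false

/-! The proof rests on two estimates for the Mahler basis functions binom(x, ν).

Upper bound. Vandermonde's identity and (j+1) binom(h, j+1) = h binom(h-1, j) express the slope of
binom(y - c, n) based at x₀ as a combination of the functions binom(y - (x₀+1), j), j < n, with
coefficients of norm at most |1/(j+1)| ≤ j+1 ≤ n. By iteration, the difference quotient of order β
of binom(·, ν) extends continuously (`sum_nodal_inv_mul_choose`) and is bounded by ν^β
(`norm_ddChoose_le`). If q(b_ν) ν^β → 0 for all q, then ∑ binom(·, ν) b_ν can be differenced term by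
term, and the new series is a continuous extension (`continuous_ddSum`, `diffQuot_mahlerSum`).

Lower bound. Given f^{<β>}, insert in each variable the nodes x₀ = k₀, x_{s+1} = x_s + 1 + k_{s+1}.
This yields a continuous function of the p-adic integers k, whose Mahler coefficient at k is a_ν(f)
divided by an explicit integer, where ν_i = ∑_s k_{i,s} + β_i (`newtonCoeff_extOfNodes`). These
coefficients tend to 0 by Mahler's theorem in several variables (`tendsto_newtonCoeff`), and q of
them is at most the supremum of q over f^{<β>}. For each ν, some β' ≤ β and some k make the integer
so divisible by p that its inverse has norm at least a constant times ν^β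
(`exists_monomialWeight_le`). The decay of the coefficients and the continuity of f ↦ (a_ν(f))
follow.

Sparse weights suffice, because within a block all exponents can be moved to the largest coordinate
of ν (`exists_finset_sparseBlockIndices`); the same maximum argument compares |ν|^r with the weights
ν_i^r. -/

noncomputable section

/-! ### Newton coefficients of functions on `ℕ^κ` -/

section Newton

variable {κ M R : Type*} [Fintype κ] [DecidableEq κ] [AddCommGroup M]

/-- The signed binomial coefficient `(-1)^(n-m) binom(n,m)`. -/
def newtonWeight (n m : ℕ) : ℤ := (-1) ^ (n - m) * (n.choose m : ℤ)

/-- The one-variable Newton coefficient `∑_{m ≤ n} (-1)^(n-m) binom(n,m) g(m)`. -/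
def newtonCoeffNat (g : ℕ → M) (n : ℕ) : M := ∑ m ∈ Finset.Iic n, newtonWeight n m • g m

/-- The Newton coefficient of a function on `ℕ^κ`. -/
def newtonCoeff (g : (κ → ℕ) → M) (ν : κ → ℕ) : M :=
  ∑ μ ∈ Finset.Iic ν, (∏ i, newtonWeight (ν i) (μ i)) • g μ

lemma finset_Iic_pi (ν : κ → ℕ) :
    Finset.Iic ν = Fintype.piFinset fun i => Finset.Iic (ν i) := rfl

lemma newtonCoeffNat_eq_fwdDiff (g : ℕ → M) (n : ℕ) :
    newtonCoeffNat g n = (fwdDiff 1)^[n] g 0 := by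
  rw [fwdDiff_iter_eq_sum_shift, newtonCoeffNat, ← Nat.range_succ_eq_Iic]
  simp [newtonWeight]

lemma newtonCoeffNat_choose [Ring R] (l n : ℕ) :
    newtonCoeffNat (fun m => (m.choose l : R)) n = if n = l then 1 else 0 := by
  have h := fwdDiff_iter_choose_zero l n
  rw [← newtonCoeffNat_eq_fwdDiff] at h
  have := congrArg (Int.cast : ℤ → R) h
  rw [newtonCoeffNat, Int.cast_sum] at this
  simpa [newtonCoeffNat] using this

lemma newtonCoeff_finset_sum {X : Type*} (s : Finset X) (g : X → (κ → ℕ) → M) (ν : κ → ℕ) :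
    newtonCoeff (fun μ => ∑ x ∈ s, g x μ) ν = ∑ x ∈ s, newtonCoeff (g x) ν := by
  simp only [newtonCoeff, Finset.smul_sum]
  exact Finset.sum_comm

lemma newtonCoeff_smul_const [Ring R] [Module R M] (g : (κ → ℕ) → R) (e : M) (ν : κ → ℕ) :
    newtonCoeff (fun μ => g μ • e) ν = newtonCoeff g ν • e := by
  simp only [newtonCoeff, Finset.sum_smul, smul_assoc]

lemma newtonCoeff_const_mul [Ring R] (c : R) (g : (κ → ℕ) → R) (ν : κ → ℕ) :
    newtonCoeff (fun μ => c * g μ) ν = c * newtonCoeff g ν := by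
  simp only [newtonCoeff, Finset.mul_sum, mul_smul_comm]

lemma newtonCoeff_congr {g h : (κ → ℕ) → M} {ν : κ → ℕ} (H : ∀ μ ≤ ν, g μ = h μ) :
    newtonCoeff g ν = newtonCoeff h ν :=
  Finset.sum_congr rfl fun μ hμ => by rw [H μ (Finset.mem_Iic.1 hμ)]

lemma newtonCoeff_prod [CommRing R] (g : κ → ℕ → R) (ν : κ → ℕ) :
    newtonCoeff (fun μ => ∏ i, g i (μ i)) ν = ∏ i, newtonCoeffNat (g i) (ν i) := by
  simp only [newtonCoeff, newtonCoeffNat]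
  rw [Finset.prod_univ_sum, finset_Iic_pi]
  refine Finset.sum_congr rfl fun μ _ => ?_
  simp only [zsmul_eq_mul, Finset.prod_mul_distrib, Int.cast_prod]

lemma newtonCoeff_choose [CommRing R] (l ν : κ → ℕ) :
    newtonCoeff (fun μ => ∏ i, ((μ i).choose (l i) : R)) ν = if ν = l then 1 else 0 := by
  rw [newtonCoeff_prod fun i m => ((m.choose (l i) : ℕ) : R)]
  simp only [newtonCoeffNat_choose, Finset.prod_ite_zero, funext_iff, Finset.mem_univ,
    true_implies, Finset.prod_const_one]

lemma newtonCoeff_sigma {ι : Type*} {τ : ι → Type*} [Fintype ι] [DecidableEq ι]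
    [∀ i, Fintype (τ i)] [∀ i, DecidableEq (τ i)] [CommRing R]
    (g : ∀ i, (τ i → ℕ) → R) (ν : (Σ i, τ i) → ℕ) :
    newtonCoeff (fun μ : (Σ i, τ i) → ℕ => ∏ i, g i fun t => μ ⟨i, t⟩) ν =
      ∏ i, newtonCoeff (g i) fun t => ν ⟨i, t⟩ := by
  simp only [newtonCoeff]
  rw [Finset.prod_univ_sum]
  refine Finset.sum_equiv (Equiv.piCurry fun _ _ => ℕ) (fun μ => ?_) fun μ _ => ?_
  · simp [Fintype.mem_piFinset, Pi.le_def, Sigma.forall, Sigma.curry]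
  · simp [Fintype.prod_sigma, Finset.prod_mul_distrib]
    rfl

lemma newtonCoeff_cons [CommRing R] {r : ℕ} (g : ℕ → R) (h : (Fin r → ℕ) → R)
    (ν : Fin (r + 1) → ℕ) :
    newtonCoeff (fun μ : Fin (r + 1) → ℕ => g (μ 0) * h (Fin.tail μ)) ν =
      newtonCoeffNat g (ν 0) * newtonCoeff h (Fin.tail ν) := by
  simp only [newtonCoeff, newtonCoeffNat]
  rw [Finset.sum_mul_sum, ← Finset.sum_product']
  refine Finset.sum_nbij' (fun μ => (μ 0, Fin.tail μ)) (fun x => Fin.cons x.1 x.2) ?_ ?_ ?_ ?_ ?_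
  · intro μ hμ
    simp only [Finset.mem_Iic, Pi.le_def, Fin.forall_fin_succ, Finset.mem_product, Fin.tail] at *
    exact hμ
  · intro x hx
    simp only [Finset.mem_Iic, Pi.le_def, Fin.forall_fin_succ, Finset.mem_product, Fin.tail,
      Fin.cons_zero, Fin.cons_succ] at *
    exact hx
  · simp
  · simp
  · intro μ _
    simp only [Fin.prod_univ_succ, Fin.tail, zsmul_eq_mul, Int.cast_mul]
    ring

/-- Newton's forward difference formula for the indicator function of `m`, evaluated at `n`. -/
lemma sum_choose_mul_newtonWeight (n m : ℕ) :
    ∑ l ∈ Finset.Iic n, (n.choose l : ℤ) * newtonWeight l m = if m = n then 1 else 0 := by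
  have h := shift_eq_sum_fwdDiff_iter (1 : ℕ) (fun x : ℕ => if m = x then (1 : ℤ) else 0) n 0
  simp only [smul_eq_mul, mul_one, zero_add, ← newtonCoeffNat_eq_fwdDiff] at h
  rw [h, ← Nat.range_succ_eq_Iic]
  refine Finset.sum_congr rfl fun l _ => ?_
  rw [newtonCoeffNat]
  simp only [smul_eq_mul, mul_ite, mul_one, mul_zero, Finset.sum_ite_eq, Finset.mem_Iic,
    nsmul_eq_mul]
  split_ifs with hm
  · rfl
  · rw [newtonWeight, Nat.choose_eq_zero_of_lt (not_le.1 hm)]; simp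

/-- Newton's expansion of a function on `ℕ^κ`. -/
lemma sum_choose_smul_newtonCoeff (g : (κ → ℕ) → M) {B μ : κ → ℕ} (hB : μ ≤ B) :
    ∑ ν ∈ Finset.Iic B, (∏ i, ((μ i).choose (ν i) : ℤ)) • newtonCoeff g ν = g μ := by
  have h1 : ∑ ν ∈ Finset.Iic B, (∏ i, ((μ i).choose (ν i) : ℤ)) • newtonCoeff g ν =
      ∑ ν ∈ Finset.Iic μ, (∏ i, ((μ i).choose (ν i) : ℤ)) • newtonCoeff g ν := by
    refine (Finset.sum_subset (Finset.Iic_subset_Iic.2 hB) fun ν _ hν => ?_).symm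
    obtain ⟨i, hi⟩ : ∃ i, μ i < ν i := by
      by_contra! h
      exact hν (Finset.mem_Iic.2 h)
    rw [Finset.prod_eq_zero (Finset.mem_univ i) (by simp [Nat.choose_eq_zero_of_lt hi]), zero_smul]
  -- The inner sums are enlarged to one common box so that the order of summation can be exchanged;
  -- the added terms contain a vanishing binomial coefficient.
  have h2 : ∀ ν ∈ Finset.Iic μ, newtonCoeff g ν =
      ∑ l ∈ Finset.Iic μ, (∏ i, newtonWeight (ν i) (l i)) • g l := by
    intro ν hν
    refine Finset.sum_subset (Finset.Iic_subset_Iic.2 (Finset.mem_Iic.1 hν)) fun l _ hl => ?_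
    obtain ⟨i, hi⟩ : ∃ i, ν i < l i := by
      by_contra! h
      exact hl (Finset.mem_Iic.2 h)
    rw [Finset.prod_eq_zero (Finset.mem_univ i)
      (by simp [newtonWeight, Nat.choose_eq_zero_of_lt hi]), zero_smul]
  rw [h1, Finset.sum_congr rfl fun ν hν => by rw [h2 ν hν, Finset.smul_sum], Finset.sum_comm]
  have h3 : ∀ l, ∑ ν ∈ Finset.Iic μ, (∏ i, ((μ i).choose (ν i) : ℤ)) •
      (∏ i, newtonWeight (ν i) (l i)) • g l = if l = μ then g l else 0 := by
    intro l
    simp only [smul_smul, ← Finset.sum_smul, ← Finset.prod_mul_distrib]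
    rw [finset_Iic_pi, ← Finset.prod_univ_sum (fun i => Finset.Iic (μ i))
      (fun i m => ((μ i).choose m : ℤ) * newtonWeight m (l i))]
    simp only [sum_choose_mul_newtonWeight, Finset.prod_ite_zero, Finset.mem_univ,
      Finset.prod_const_one, true_implies]
    by_cases hl : l = μ
    · simp [hl]
    · rw [if_neg (fun h => hl (funext h)), if_neg hl, zero_smul]
  simp [h3]

/-- Newton coefficients are integer combinations of values, and integer multiples do not increase an
ultrametric seminorm. -/
lemma seminorm_newtonCoeff_le {K : Type*} [NormedField K] [Module K M] {q : Seminorm K M}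
    (hq : IsNonarchimedean q) {g : (κ → ℕ) → M} {C : ℝ} (hC : ∀ μ, q (g μ) ≤ C)
    (ν : κ → ℕ) : q (newtonCoeff g ν) ≤ C := by
  have hz : ∀ (n : ℤ) (x : M), q (n • x) ≤ q x := by
    have hn : ∀ (n : ℕ) (x : M), q (n • x) ≤ q x := by
      intro n x
      induction n with
      | zero => simp
      | succ n ih => rw [succ_nsmul]; exact (hq _ _).trans (max_le ih le_rfl)
    intro n x
    obtain ⟨n, rfl | rfl⟩ := n.eq_nat_or_neg
    · simpa using hn n x
    · simpa using hn n x
  have hC0 : 0 ≤ C := (apply_nonneg q _).trans (hC 0)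
  rw [newtonCoeff]
  refine Finset.sum_induction _ (fun x => q x ≤ C) (fun x y hx hy => (hq x y).trans (max_le hx hy))
    (by simpa using hC0) fun μ _ => (hz _ _).trans (hC μ)

lemma mahlerCoeff_eq_newtonCoeff {p : ℕ} [Fact p.Prime] (f : zpCube p κ → M) (ν : κ → ℕ) :
    mahlerCoeff f ν = newtonCoeff (fun μ => f ⟨_, natCast_mem_zpCube p μ⟩) ν := by
  refine Finset.sum_congr rfl fun μ hμ => ?_
  have hμ' : ∀ i, μ i ≤ ν i := Finset.mem_Iic.1 hμ
  congr 1
  simp only [newtonWeight, Finset.prod_mul_distrib, Finset.prod_pow_eq_pow_sum]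
  rw [Finset.sum_tsub_distrib _ fun i _ => hμ' i]

end Newton

/-! ### Divided differences of binomial coefficient functions -/

section DividedDifferences

/-- The sum is the coefficient of `X ^ (r + 1)` in the Lagrange interpolation of the constant
polynomial 1. -/
lemma sum_nodal_inv_eq_zero {K : Type*} [Field K] {r : ℕ} {x : Fin (r + 2) → K}
    (hx : Function.Injective x) :
    ∑ j, ∏ k ∈ Finset.univ.erase j, (x j - x k)⁻¹ = 0 := by
  have h := Lagrange.coeff_eq_sum (P := (1 : Polynomial K)) (s := Finset.univ) (v := x)
    hx.injOn (by rw [Polynomial.degree_one, Finset.card_fin]; norm_cast; omega)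
  simpa [Polynomial.coeff_one, Finset.prod_inv_distrib] using h.symm

/-- The divided difference of a function is that of its slope based at `x 0`, taken over the
remaining nodes. As the nodal weights sum to zero, `y 0` can be subtracted from all values; then the
term `j = 0` disappears and the others split off their factor `k = 0`. -/
lemma dividedDifference_succ {K : Type*} [Field K] {r : ℕ} {x : Fin (r + 2) → K}
    (hx : Function.Injective x) (y : Fin (r + 2) → K) :
    ∑ j, (∏ k ∈ Finset.univ.erase j, (x j - x k)⁻¹) * y j =
      ∑ j : Fin (r + 1), (∏ k ∈ Finset.univ.erase j, (x j.succ - x k.succ)⁻¹) *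
        ((x j.succ - x 0)⁻¹ * (y j.succ - y 0)) := by
  have h1 : ∑ j, (∏ k ∈ Finset.univ.erase j, (x j - x k)⁻¹) * y j =
      ∑ j, (∏ k ∈ Finset.univ.erase j, (x j - x k)⁻¹) * (y j - y 0) := by
    simp only [mul_sub, Finset.sum_sub_distrib, ← Finset.sum_mul, sum_nodal_inv_eq_zero hx,
      zero_mul, sub_zero]
  rw [h1, Fin.sum_univ_succ, sub_self, mul_zero, zero_add]
  refine Finset.sum_congr rfl fun j _ => ?_
  have h2 : (Finset.univ.erase j.succ : Finset (Fin (r + 2))) =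
      insert 0 ((Finset.univ.erase j).map (Fin.succEmb (r + 1))) := by
    ext k
    refine Fin.cases ?_ (fun k => ?_) k
    · simp [(Fin.succ_ne_zero j).symm]
    · simp [Fin.succ_ne_zero]
  rw [h2, Finset.prod_insert (by simp [Fin.succ_ne_zero]), Finset.prod_map]
  simp only [Fin.coe_succEmb]
  ring

variable {p : ℕ} [Fact p.Prime]

/-- The continuous extension of the divided difference of order `r` of `y ↦ binom(y - c, n)`. -/
def ddChoose : (r : ℕ) → ℕ → ℤ_[p] → (Fin (r + 1) → ℤ_[p]) → ℚ_[p]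
  | 0, n, c, x => (Ring.choose (x 0 - c) n : ℤ_[p])
  -- The slope of binom(y - c, n) based at `x 0` combines the functions binom(y - (x 0 + 1), j);
  -- hence the base point moves from `c` to `x 0 + 1`.
  | r + 1, n, c, x => ∑ j ∈ Finset.range n, ((j + 1 : ℕ) : ℚ_[p])⁻¹ *
      (Ring.choose (x 0 - c) (n - 1 - j) : ℤ_[p]) * ddChoose r j (x 0 + 1) (Fin.tail x)

lemma continuous_ddChoose (r n : ℕ) :
    Continuous fun z : ℤ_[p] × (Fin (r + 1) → ℤ_[p]) => ddChoose r n z.1 z.2 := by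
  induction r generalizing n with
  | zero =>
    simp only [ddChoose]
    exact continuous_subtype_val.comp ((PadicInt.continuous_choose n).comp (by fun_prop))
  | succ r ih =>
    simp only [ddChoose]
    refine continuous_finsetSum _ fun j _ => ?_
    refine (continuous_const.mul
      (continuous_subtype_val.comp ((PadicInt.continuous_choose _).comp (by fun_prop)))).mul ?_
    refine (ih j).comp (f := fun z : ℤ_[p] × (Fin (r + 1 + 1) → ℤ_[p]) => (z.2 0 + 1, Fin.tail z.2)) ?_
    refine Continuous.prodMk (by fun_prop) ?_
    exact continuous_pi fun i => by simp only [Fin.tail]; fun_prop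

/-- The left side is the exact power of `p` dividing `j + 1`. -/
lemma norm_natCast_inv_le (j : ℕ) : ‖((j + 1 : ℕ) : ℚ_[p])⁻¹‖ ≤ (j + 1 : ℕ) := by
  have hp : 1 < p := (Fact.out : p.Prime).one_lt
  rw [norm_inv, Padic.norm_eq_zpow_neg_valuation (Nat.cast_ne_zero.2 j.succ_ne_zero),
    zpow_neg, inv_inv, Padic.valuation_natCast, zpow_natCast]
  exact_mod_cast Nat.le_of_dvd j.succ_pos pow_padicValNat_dvd

/-- Each step of the recursion costs a factor of at most `j + 1 ≤ n`, binomial coefficients being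
p-adic integers. -/
lemma norm_ddChoose_le (r n : ℕ) (c : ℤ_[p]) (x : Fin (r + 1) → ℤ_[p]) :
    ‖ddChoose r n c x‖ ≤ (n : ℝ) ^ r := by
  induction r generalizing n c with
  | zero => simpa [ddChoose] using PadicInt.norm_le_one _
  | succ r ih =>
    rw [ddChoose]
    refine IsUltrametricDist.norm_sum_le_of_forall_le_of_nonneg (by positivity) fun j hj => ?_
    have hj' : j + 1 ≤ n := Finset.mem_range.1 hj
    rw [norm_mul, norm_mul, pow_succ, mul_comm ((n : ℝ) ^ r)]
    have h1 : ‖((Ring.choose (x 0 - c) (n - 1 - j) : ℤ_[p]) : ℚ_[p])‖ ≤ 1 :=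
      PadicInt.norm_le_one _
    have h2 := norm_natCast_inv_le (p := p) j
    have h3 : ((j + 1 : ℕ) : ℝ) ≤ n := by exact_mod_cast hj'
    have h4 : ((j : ℕ) : ℝ) ^ r ≤ (n : ℝ) ^ r := by gcongr; exact_mod_cast (Nat.le_of_succ_le hj')
    calc _ ≤ ((j + 1 : ℕ) : ℝ) * 1 * (j : ℝ) ^ r := by
          gcongr
          exact ih _ _ _
      _ ≤ _ := by rw [mul_one]; gcongr

/-- Both sides are continuous in `h`, and they agree on the positive integers, which are dense. -/
lemma succ_mul_choose_succ (h : ℤ_[p]) (j : ℕ) :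
    ((j + 1 : ℕ) : ℤ_[p]) * Ring.choose h (j + 1) = h * Ring.choose (h - 1) j := by
  have h1 : Continuous fun h : ℤ_[p] => ((j + 1 : ℕ) : ℤ_[p]) * Ring.choose h (j + 1) :=
    continuous_const.mul (PadicInt.continuous_choose _)
  have h2 : Continuous fun h : ℤ_[p] => h * Ring.choose (h - 1) j :=
    continuous_id.mul ((PadicInt.continuous_choose _).comp (by fun_prop))
  have h3 : Dense (Set.range fun n : ℕ => ((n + 1 : ℕ) : ℤ_[p])) := by
    have := (Equiv.addRight (1 : ℤ_[p])).surjective.denseRange.comp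
      (PadicInt.denseRange_natCast (p := p)) (by simpa using continuous_add_const (1 : ℤ_[p]))
    simpa [DenseRange, Function.comp_def] using this
  refine congrFun (h1.ext_on h3 h2 ?_) h
  rintro _ ⟨n, rfl⟩
  have : ((n + 1 : ℕ) : ℤ_[p]) - 1 = (n : ℤ_[p]) := by push_cast; ring
  simp only [this, Ring.choose_natCast]
  have := Nat.add_one_mul_choose_eq n j
  exact_mod_cast (by linarith : (j + 1) * (n + 1).choose (j + 1) = (n + 1) * n.choose j)

/-- Vandermonde's identity for `y - c = (y - x₀) + (x₀ - c)`. The term of index 0 is the one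
subtracted; `succ_mul_choose_succ` extracts the factor `y - x₀` from the others. -/
lemma choose_sub_choose (y x₀ c : ℤ_[p]) (n : ℕ) :
    ((Ring.choose (y - c) n : ℤ_[p]) : ℚ_[p]) - (Ring.choose (x₀ - c) n : ℤ_[p]) =
      ((y : ℚ_[p]) - x₀) * ∑ j ∈ Finset.range n, ((j + 1 : ℕ) : ℚ_[p])⁻¹ *
        (Ring.choose (x₀ - c) (n - 1 - j) : ℤ_[p]) *
        (Ring.choose (y - (x₀ + 1)) j : ℤ_[p]) := by
  have h := Ring.add_choose_eq (r := y - x₀) (s := x₀ - c) n (Commute.all _ _)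
  rw [sub_add_sub_cancel, Finset.Nat.sum_antidiagonal_eq_sum_range_succ
    (fun i j => Ring.choose (y - x₀) i * Ring.choose (x₀ - c) j), Finset.sum_range_succ'] at h
  simp only [Ring.choose_zero_right, one_mul, tsub_zero] at h
  rw [h]
  rw [PadicInt.coe_add, add_sub_cancel_right, PadicInt.coe_sum, Finset.mul_sum]
  refine Finset.sum_congr rfl fun j _ => ?_
  have h1 : (((j + 1 : ℕ) : ℤ_[p]) * Ring.choose (y - x₀) (j + 1) : ℤ_[p]) =
    (((y - x₀) * Ring.choose (y - x₀ - 1) j : ℤ_[p]) : ℚ_[p]) := by rw [succ_mul_choose_succ]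
  simp only [PadicInt.coe_mul, PadicInt.coe_natCast, PadicInt.coe_sub, sub_sub] at h1
  have h0 : ((j + 1 : ℕ) : ℚ_[p]) ≠ 0 := Nat.cast_ne_zero.2 j.succ_ne_zero
  have h2 : ((Ring.choose (y - x₀) (j + 1) : ℤ_[p]) : ℚ_[p]) = ((j + 1 : ℕ) : ℚ_[p])⁻¹ *
      (((y : ℚ_[p]) - x₀) * (Ring.choose (y - (x₀ + 1)) j : ℤ_[p])) := by
    rw [← h1, inv_mul_cancel_left₀ h0]
  rw [show n - (j + 1) = n - 1 - j by omega]
  refine (PadicInt.coe_mul _ _).trans ?_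
  rw [h2]
  ring

lemma sum_nodal_inv_mul_choose (r n : ℕ) (c : ℤ_[p]) {x : Fin (r + 1) → ℤ_[p]}
    (hx : Function.Injective x) :
    ∑ j, (∏ k ∈ Finset.univ.erase j, ((x j : ℚ_[p]) - x k)⁻¹) * (Ring.choose (x j - c) n : ℤ_[p]) =
      ddChoose r n c x := by
  induction r generalizing n c with
  | zero => simp [ddChoose]
  | succ r ih =>
    have hx' : Function.Injective (Fin.tail x) := hx.comp (Fin.succ_injective _)
    rw [dividedDifference_succ (x := fun j => (x j : ℚ_[p])) (Subtype.val_injective.comp hx)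
      (fun j => ((Ring.choose (x j - c) n : ℤ_[p]) : ℚ_[p])), ddChoose]
    have h1 : ∀ j : Fin (r + 1), ((x j.succ : ℚ_[p]) - x 0)⁻¹ *
        ((Ring.choose (x j.succ - c) n : ℤ_[p]) - (Ring.choose (x 0 - c) n : ℤ_[p])) =
        ∑ l ∈ Finset.range n, ((l + 1 : ℕ) : ℚ_[p])⁻¹ *
        (Ring.choose (x 0 - c) (n - 1 - l) : ℤ_[p]) *
        (Ring.choose (x j.succ - (x 0 + 1)) l : ℤ_[p]) := by
      intro j
      have h0 : (x j.succ : ℚ_[p]) - x 0 ≠ 0 :=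
        sub_ne_zero.2 fun h => Fin.succ_ne_zero j (hx (Subtype.val_injective h))
      rw [choose_sub_choose, inv_mul_cancel_left₀ h0]
    simp only [h1, Finset.mul_sum]
    rw [Finset.sum_comm]
    refine Finset.sum_congr rfl fun l _ => ?_
    rw [← ih l (x 0 + 1) hx', Finset.mul_sum]
    refine Finset.sum_congr rfl fun j _ => ?_
    simp only [Fin.tail]
    ring

/-- The tuple `x` with `x₀ = c + k₀` and `x_{s+1} = x_s + 1 + k_{s+1}`. -/
def nodes {R : Type*} [Semiring R] : (r : ℕ) → R → (Fin (r + 1) → R) → Fin (r + 1) → R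
  | 0, c, k => fun _ => c + k 0
  | r + 1, c, k => Fin.cons (c + k 0) (nodes r (c + k 0 + 1) (Fin.tail k))

lemma continuous_nodes {R : Type*} [Semiring R] [TopologicalSpace R] [ContinuousAdd R] (r : ℕ) :
    Continuous fun z : R × (Fin (r + 1) → R) => nodes r z.1 z.2 := by
  induction r with
  | zero => simp only [nodes]; fun_prop
  | succ r ih =>
    refine continuous_pi fun j => Fin.cases ?_ (fun j => ?_) j
    · simp only [nodes, Fin.cons_zero]; fun_prop
    · simp only [nodes, Fin.cons_succ]
      refine (continuous_apply j).comp (ih.comp (f := fun z : R × (Fin (r + 1 + 1) → R) =>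
        (z.1 + z.2 0 + 1, Fin.tail z.2)) (Continuous.prodMk (by fun_prop) ?_))
      exact continuous_pi fun i => by simp only [Fin.tail]; fun_prop

lemma nodes_natCast {R : Type*} [Semiring R] (r c : ℕ) (k : Fin (r + 1) → ℕ) (j : Fin (r + 1)) :
    nodes r (c : R) (fun i => (k i : R)) j = (nodes r c k j : ℕ) := by
  induction r generalizing c with
  | zero => simp [nodes]
  | succ r ih =>
    refine Fin.cases ?_ (fun j => ?_) j
    · simp [nodes]
    · simp only [nodes, Fin.cons_succ, ← ih]
      push_cast
      rfl

lemma le_nodes (r c : ℕ) (k : Fin (r + 1) → ℕ) (j : Fin (r + 1)) : c ≤ nodes r c k j := by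
  induction r generalizing c with
  | zero => simp [nodes]
  | succ r ih =>
    refine Fin.cases ?_ (fun j => ?_) j
    · simp [nodes]
    · simp only [nodes, Fin.cons_succ]
      have := ih (c + k 0 + 1) (Fin.tail k) j
      omega

lemma nodes_injective (r c : ℕ) (k : Fin (r + 1) → ℕ) : Function.Injective (nodes r c k) := by
  induction r generalizing c with
  | zero => exact fun a b _ => Subsingleton.elim (α := Fin 1) a b
  | succ r ih =>
    rw [nodes, Fin.cons_injective_iff]
    refine ⟨?_, ih _ _⟩
    rintro ⟨j, hj⟩
    have := le_nodes r (c + k 0 + 1) (Fin.tail k) j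
    omega

/-- `ddChoose r n c (nodes r c k)` for `k : Fin (r + 1) → ℕ`. -/
def ddChooseNodes (p : ℕ) [Fact p.Prime] : (r : ℕ) → ℕ → (Fin (r + 1) → ℕ) → ℚ_[p]
  | 0, n, k => ((k 0).choose n : ℚ_[p])
  | r + 1, n, k => ∑ j ∈ Finset.range n, ((j + 1 : ℕ) : ℚ_[p])⁻¹ *
      (((k 0).choose (n - 1 - j) : ℚ_[p]) * ddChooseNodes p r j (Fin.tail k))

/-- The nodes follow the recursion of `ddChoose`: `x₀ - c = k₀`, and the next base point `x₀ + 1` is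
where the tail of the nodes starts. Thus the binomials depend on separate variables `k_s`. -/
lemma ddChoose_nodes (r n c : ℕ) (k : Fin (r + 1) → ℕ) :
    ddChoose (p := p) r n c (nodes r (c : ℤ_[p]) fun i => (k i : ℤ_[p])) =
      ddChooseNodes p r n k := by
  induction r generalizing n c with
  | zero => simp [ddChoose, nodes, ddChooseNodes, Ring.choose_natCast]
  | succ r ih =>
    simp only [ddChoose, nodes, ddChooseNodes, Fin.cons_zero, Fin.tail_cons, add_sub_cancel_left,
      Ring.choose_natCast, mul_assoc]
    refine Finset.sum_congr rfl fun j _ => ?_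
    have := ih j (c + k 0 + 1) (Fin.tail k)
    push_cast at this
    rw [← this]
    simp [Fin.tail_def]

/-- The product `∏_{s=1}^r (i_s + ⋯ + i_r + r - s + 1)`. -/
def nodeDenom : (r : ℕ) → (Fin (r + 1) → ℕ) → ℕ
  | 0, _ => 1
  | r + 1, i => (∑ s, Fin.tail i s + r + 1) * nodeDenom r (Fin.tail i)

/-- Newton coefficients of products of binomials in separate variables are Kronecker deltas. In the
recursion only `j = ∑ s, Fin.tail i s + r` survives, and its `1 / (j + 1)` contributes the next
factor of `nodeDenom`. -/
lemma newtonCoeff_ddChooseNodes (r n : ℕ) (i : Fin (r + 1) → ℕ) :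
    newtonCoeff (ddChooseNodes p r n) i =
      if ∑ s, i s + r = n then (nodeDenom r i : ℚ_[p])⁻¹ else 0 := by
  induction r generalizing n with
  | zero =>
    have : ddChooseNodes p 0 n = fun k => ∏ s, ((k s).choose n : ℚ_[p]) := by
      funext k; simp [ddChooseNodes]
    rw [this, newtonCoeff_choose (fun _ => n)]
    simp [funext_iff, nodeDenom]
  | succ r ih =>
    have : ddChooseNodes p (r + 1) n = fun k => ∑ j ∈ Finset.range n, ((j + 1 : ℕ) : ℚ_[p])⁻¹ *
      (((k 0).choose (n - 1 - j) : ℚ_[p]) * ddChooseNodes p r j (Fin.tail k)) := by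
      funext k; rw [ddChooseNodes]
    rw [this, newtonCoeff_finset_sum]
    have h2 : ∀ j, newtonCoeff (fun k : Fin (r + 2) → ℕ => ((j + 1 : ℕ) : ℚ_[p])⁻¹ *
      (((k 0).choose (n - 1 - j) : ℚ_[p]) * ddChooseNodes p r j (Fin.tail k))) i =
      if ∑ s, Fin.tail i s + r = j then
        (if i 0 = n - 1 - j then (nodeDenom (r + 1) i : ℚ_[p])⁻¹ else 0) else 0 := by
      intro j
      rw [newtonCoeff_const_mul, newtonCoeff_cons (fun m => (m.choose (n - 1 - j) : ℚ_[p])),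
        newtonCoeffNat_choose, ih]
      split_ifs with h3 h4 h4
      · rw [nodeDenom, h4, Nat.cast_mul, mul_inv, one_mul]
      · simp
      · simp
      · simp
    simp only [h2]
    rw [Finset.sum_ite_eq, ← ite_and]
    refine if_congr ?_ rfl rfl
    rw [Finset.mem_range, Fin.sum_univ_succ i]
    simp only [Fin.tail]
    omega

end DividedDifferences

/-! ### Seminorms on locally convex spaces over an ultrametric field -/

section Gauge

variable {K E : Type*} [NontriviallyNormedField K] [AddCommGroup E] [Module K E]

/-- The Minkowski functional of an additive subgroup. -/
def subgroupGauge (K : Type*) {E : Type*} [NontriviallyNormedField K] [AddCommGroup E]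
    [Module K E] (M : AddSubgroup E) (x : E) : ℝ :=
  sInf {t | ∃ c : K, c ≠ 0 ∧ c⁻¹ • x ∈ M ∧ ‖c‖ = t}

variable {M : AddSubgroup E}

lemma subgroupGauge_le {x : E} {c : K} (hc : c ≠ 0) (hx : c⁻¹ • x ∈ M) :
    subgroupGauge K M x ≤ ‖c‖ :=
  csInf_le ⟨0, by rintro _ ⟨c, -, -, rfl⟩; exact norm_nonneg c⟩ ⟨c, hc, hx, rfl⟩

lemma subgroupGauge_nonneg (M : AddSubgroup E) (x : E) : 0 ≤ subgroupGauge K M x :=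
  Real.sInf_nonneg (by rintro _ ⟨c, -, -, rfl⟩; exact norm_nonneg c)

lemma subgroupGauge_zero : subgroupGauge K M 0 = 0 := by
  refine le_antisymm (le_of_forall_gt fun t ht => ?_) (subgroupGauge_nonneg M 0)
  obtain ⟨c, hc, hct⟩ := NormedField.exists_norm_lt K ht
  exact (subgroupGauge_le (norm_pos_iff.1 hc) (by simp)).trans_lt hct

variable [TopologicalSpace E] [ContinuousSMul K E]

lemma exists_inv_smul_mem (hM : IsOpen (M : Set E)) (x : E) :
    ∃ c : K, c ≠ 0 ∧ c⁻¹ • x ∈ M := by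
  have h : Tendsto (fun c : K => c • x) (𝓝[≠] 0) (𝓝 0) := by
    have : Tendsto (fun c : K => c • x) (𝓝 0) (𝓝 ((0 : K) • x)) :=
      (continuous_id.smul continuous_const).tendsto 0
    rw [zero_smul] at this
    exact this.mono_left nhdsWithin_le_nhds
  obtain ⟨c, hc, hc0⟩ := ((h.eventually (hM.mem_nhds M.zero_mem)).and
    self_mem_nhdsWithin).exists
  exact ⟨c⁻¹, inv_ne_zero hc0, by rwa [inv_inv]⟩

lemma exists_of_subgroupGauge_lt (hM : IsOpen (M : Set E)) {x : E} {t : ℝ}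
    (h : subgroupGauge K M x < t) : ∃ c : K, c ≠ 0 ∧ c⁻¹ • x ∈ M ∧ ‖c‖ < t := by
  obtain ⟨c, hc, hx⟩ := exists_inv_smul_mem (K := K) hM x
  have hne : {t | ∃ c : K, c ≠ 0 ∧ c⁻¹ • x ∈ M ∧ ‖c‖ = t}.Nonempty := ⟨‖c‖, c, hc, hx, rfl⟩
  obtain ⟨_, ⟨c, hc, hx, rfl⟩, hlt⟩ := exists_lt_of_csInf_lt hne h
  exact ⟨c, hc, hx, hlt⟩

lemma subgroupGauge_add_le (hM : IsOpen (M : Set E))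
    (hs : ∀ c : K, ‖c‖ ≤ 1 → ∀ x ∈ M, c • x ∈ M) (x y : E) :
    subgroupGauge K M (x + y) ≤ max (subgroupGauge K M x) (subgroupGauge K M y) := by
  refine le_of_forall_gt fun t ht => ?_
  obtain ⟨c, hc, hx, hct⟩ := exists_of_subgroupGauge_lt hM ((le_max_left _ _).trans_lt ht)
  obtain ⟨d, hd, hy, hdt⟩ := exists_of_subgroupGauge_lt hM ((le_max_right _ _).trans_lt ht)
  -- A larger scalar also works, since `M` is stable under scalars of norm at most 1; so the larger
  -- of `c`, `d` serves for both vectors.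
  have key : ∀ {c d : K} {x : E}, c ≠ 0 → d ≠ 0 → ‖c‖ ≤ ‖d‖ → c⁻¹ • x ∈ M → d⁻¹ • x ∈ M := by
    intro c d x hc hd h hx
    have := hs (d⁻¹ * c) (by
      rw [norm_mul, norm_inv, inv_mul_le_iff₀ (norm_pos_iff.2 hd)]; simpa using h) _ hx
    rwa [smul_smul, mul_inv_cancel_right₀ hc] at this
  rcases le_total ‖c‖ ‖d‖ with h | h
  · refine (subgroupGauge_le hd ?_).trans_lt hdt
    rw [smul_add]
    exact M.add_mem (key hc hd h hx) hy
  · refine (subgroupGauge_le hc ?_).trans_lt hct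
    rw [smul_add]
    exact M.add_mem hx (key hd hc h hy)

lemma subgroupGauge_smul_le (hM : IsOpen (M : Set E)) (r : K) (x : E) :
    subgroupGauge K M (r • x) ≤ ‖r‖ * subgroupGauge K M x := by
  rcases eq_or_ne r 0 with rfl | hr
  · simp [subgroupGauge_zero]
  have hr' := norm_pos_iff.2 hr
  rw [← div_le_iff₀' hr']
  refine le_of_forall_gt fun t ht => ?_
  obtain ⟨c, hc, hx, hct⟩ := exists_of_subgroupGauge_lt hM ht
  rw [div_lt_iff₀' hr']
  refine (subgroupGauge_le (mul_ne_zero hr hc) ?_).trans_lt (b := ‖r * c‖) ?_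
  · rwa [mul_inv, smul_smul, mul_right_comm, inv_mul_cancel₀ hr, one_mul]
  · rw [norm_mul]; gcongr

/-- The seminorm is the gauge of an open submodule contained in `s`. -/
lemma IsUltraLocallyConvex.exists_seminorm [IsTopologicalAddGroup E]
    (hE : IsUltraLocallyConvex K E) {s : Set E} (hs : s ∈ 𝓝 0) :
    ∃ q : ContUltraSeminorm K E, ∀ x, q.1 x < 1 → x ∈ s := by
  obtain ⟨M, hM, hsm, hMs⟩ := hE s hs
  have hna := subgroupGauge_add_le (K := K) hM hsm
  let q : Seminorm K E := Seminorm.ofSMulLE (subgroupGauge K M) subgroupGauge_zero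
    (fun x y => (hna x y).trans (max_le_add_of_nonneg (subgroupGauge_nonneg M x)
      (subgroupGauge_nonneg M y))) (subgroupGauge_smul_le hM)
  refine ⟨⟨q, ?_, hna⟩, fun x hx => ?_⟩
  · refine Seminorm.continuous' (r := 1)
      (Filter.mem_of_superset (hM.mem_nhds M.zero_mem) fun x hx => ?_)
    rw [Seminorm.mem_closedBall_zero]
    have : subgroupGauge K M x ≤ ‖(1 : K)‖ := subgroupGauge_le one_ne_zero (by simpa using hx)
    rwa [norm_one] at this
  · obtain ⟨c, hc, hcx, hlt⟩ := exists_of_subgroupGauge_lt hM (show subgroupGauge K M x < 1 from hx)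
    have := hsm c hlt.le _ hcx
    rw [smul_inv_smul₀ hc] at this
    exact hMs this

end Gauge

section Summability

variable {K E : Type*} [NontriviallyNormedField K] [AddCommGroup E] [Module K E]

lemma IsNonarchimedean.seminorm_sum_le {X : Type*} {q : Seminorm K E} (hq : IsNonarchimedean q)
    {s : Finset X} {c : X → E} {C : ℝ} (hC : 0 ≤ C) (h : ∀ x ∈ s, q (c x) ≤ C) :
    q (∑ x ∈ s, c x) ≤ C :=
  Finset.sum_induction _ (fun x => q x ≤ C) (fun x y hx hy => (hq x y).trans (max_le hx hy))
    (by simpa using hC) h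

variable [UniformSpace E] [IsUniformAddGroup E] [ContinuousSMul K E]

lemma IsUltraLocallyConvex.tendsto_nhds {X : Type*} (hE : IsUltraLocallyConvex K E) {l : Filter X}
    {u : X → E} {x : E}
    (h : ∀ q : ContUltraSeminorm K E, ∀ ε > 0, ∀ᶠ i in l, q.1 (u i - x) < ε) :
    Tendsto u l (𝓝 x) := by
  rw [← tendsto_sub_nhds_zero_iff]
  intro s hs
  obtain ⟨q, hq⟩ := hE.exists_seminorm hs
  exact (h q 1 one_pos).mono fun i hi => hq _ hi

lemma IsUltraLocallyConvex.exists_seminorm_uniformity (hE : IsUltraLocallyConvex K E)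
    {s : Set (E × E)} (hs : s ∈ uniformity E) :
    ∃ q : ContUltraSeminorm K E, ∀ x y, q.1 (y - x) < 1 → (x, y) ∈ s := by
  rw [uniformity_eq_comap_nhds_zero E] at hs
  obtain ⟨t, ht, hts⟩ := hs
  obtain ⟨q, hq⟩ := hE.exists_seminorm ht
  exact ⟨q, fun x y h => hts (hq _ h)⟩

lemma seminorm_lt_mem_uniformity {q : Seminorm K E} (hq : Continuous q) {ε : ℝ} (hε : 0 < ε) :
    {z : E × E | q (z.2 - z.1) < ε} ∈ uniformity E := by
  rw [uniformity_eq_comap_nhds_zero E]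
  exact preimage_mem_comap ((isOpen_lt hq continuous_const).mem_nhds (by simpa using hε))

lemma ContUltraSeminorm.hasSum_le {X : Type*} (q : ContUltraSeminorm K E) {c : X → E} {s : E}
    (hs : HasSum c s) {C : ℝ} (hC : 0 ≤ C) (h : ∀ x, q.1 (c x) ≤ C) : q.1 s ≤ C :=
  le_of_tendsto ((q.2.1.tendsto s).comp hs)
    (Eventually.of_forall fun _ => q.2.2.seminorm_sum_le hC fun x _ => h x)

/-- In the ultrametric setting null families have Cauchy partial sums. For countable `X` some
sequence of finite sets tends to `atTop`, so sequential completeness gives a limit along it, and a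
Cauchy net converges to such a limit. -/
lemma IsUltraLocallyConvex.summable {X : Type*} [Countable X] (hE : IsUltraLocallyConvex K E)
    (hseq : ∀ u : ℕ → E, CauchySeq u → ∃ x, Tendsto u atTop (𝓝 x)) {c : X → E}
    (hc : ∀ q : ContUltraSeminorm K E, Tendsto (fun x => q.1 (c x)) cofinite (𝓝 0)) :
    Summable c := by
  have h1 : CauchySeq fun s : Finset X => ∑ x ∈ s, c x := by
    rw [cauchySeq_finset_iff_sum_vanishing]
    intro e he
    obtain ⟨q, hq⟩ := hE.exists_seminorm he
    have hfin : {x | ¬ q.1 (c x) < 1 / 2}.Finite :=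
      (hc q).eventually (gt_mem_nhds (by norm_num : (0 : ℝ) < 1 / 2))
    refine ⟨hfin.toFinset, fun t ht => hq _ (lt_of_le_of_lt (b := 1 / 2) ?_ (by norm_num))⟩
    refine q.2.2.seminorm_sum_le (by norm_num) fun x hx => le_of_lt ?_
    by_contra hx'
    exact Finset.disjoint_left.1 ht hx (hfin.mem_toFinset.2 hx')
  obtain ⟨u, hu⟩ := exists_seq_tendsto (atTop : Filter (Finset X))
  obtain ⟨x, hx⟩ := hseq _ (h1.comp_tendsto hu)
  exact ⟨x, tendsto_nhds_of_cauchySeq_of_subseq h1 hu hx⟩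

end Summability

/-! ### Decay of Newton coefficients of continuous functions on `ℤ_p^κ` -/

section Decay

variable {p : ℕ} [Fact p.Prime]

/-- All factors being at most 1, a single small factor makes the product small; the exceptional `ν`
lie in a box. -/
lemma tendsto_prod_cofinite {κ : Type*} [Fintype κ] {h : κ → ℕ → ℝ} (h0 : ∀ i n, 0 ≤ h i n)
    (h1 : ∀ i n, h i n ≤ 1) (hlim : ∀ i, Tendsto (h i) atTop (𝓝 0)) :
    Tendsto (fun ν : κ → ℕ => ∏ i, h i (ν i)) cofinite (𝓝 0) := by
  classical
  refine tendsto_order.2 ⟨fun a ha => Eventually.of_forall fun ν =>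
    ha.trans_le (Finset.prod_nonneg fun i _ => h0 i _), fun ε hε => ?_⟩
  have : ∀ i, ∃ N, ∀ n ≥ N, h i n < ε := fun i =>
    eventually_atTop.1 ((hlim i).eventually (gt_mem_nhds hε))
  choose N hN using this
  refine Set.Finite.subset (Finset.Iic N).finite_toSet fun ν hν => ?_
  rw [Finset.coe_Iic, Set.mem_Iic]
  by_contra hlt
  obtain ⟨i, hi⟩ : ∃ i, N i < ν i := by
    by_contra! hle
    exact hlt hle
  refine hν ?_
  calc ∏ i, h i (ν i) = h i (ν i) * ∏ j ∈ Finset.univ.erase i, h j (ν j) :=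
        (Finset.mul_prod_erase _ _ (Finset.mem_univ i)).symm
    _ ≤ h i (ν i) * 1 := by
        gcongr
        · exact h0 _ _
        · exact Finset.prod_le_one (fun j _ => h0 _ _) fun j _ => h1 _ _
    _ < ε := by rw [mul_one]; exact hN i _ hi.le

lemma norm_natCast_mod_le (s m : ℕ) :
    ‖(m : ℤ_[p]) - ((m % p ^ s : ℕ) : ℤ_[p])‖ ≤ (p : ℝ) ^ (-s : ℤ) := by
  have h : ((p ^ s : ℕ) : ℤ) ∣ (m : ℤ) - (m % p ^ s : ℕ) := by
    rw [Int.natCast_mod]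
    exact Int.dvd_self_sub_emod
  have := (PadicInt.norm_int_le_pow_iff_dvd (p := p)).2 h
  push_cast at this ⊢
  exact this

/-- The indicator function of the residue class of `c` modulo `p ^ s`. -/
def residueIndicator (p : ℕ) [Fact p.Prime] (s c m : ℕ) : ℚ_[p] := if m % p ^ s = c then 1 else 0

lemma norm_newtonCoeffNat_residueIndicator_le (s c n : ℕ) :
    ‖newtonCoeffNat (residueIndicator p s c) n‖ ≤ 1 := by
  refine IsUltrametricDist.norm_sum_le_of_forall_le_of_nonneg zero_le_one fun m _ => ?_
  rw [residueIndicator, zsmul_eq_mul]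
  split_ifs
  · simpa using Padic.norm_int_le_one (p := p) (newtonWeight n m)
  · simp

/-- The indicator extends to that of a clopen ball in `ℤ_[p]`, to which Mahler's theorem in one
variable applies. -/
lemma tendsto_newtonCoeffNat_residueIndicator {s c : ℕ} (hc : c < p ^ s) :
    Tendsto (fun n => newtonCoeffNat (residueIndicator p s c) n) atTop (𝓝 0) := by
  have hp : (p : ℝ) ^ (-s : ℤ) ≠ 0 := zpow_ne_zero _ (Nat.cast_ne_zero.2 (Fact.out : p.Prime).ne_zero)
  let f : C(ℤ_[p], ℤ_[p]) := ⟨(Metric.closedBall (c : ℤ_[p]) ((p : ℝ) ^ (-s : ℤ))).indicator fun _ => 1,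
    (IsUltrametricDist.isClopen_closedBall _ hp).continuous_indicator continuous_const⟩
  have hcoe : Continuous fun x : ℤ_[p] => (x : ℚ_[p]) := continuous_subtype_val
  refine ((hcoe.tendsto 0).comp (PadicInt.fwdDiff_tendsto_zero f)).congr fun n => ?_
  simp only [Function.comp_apply]
  rw [fwdDiff_iter_eq_sum_shift, newtonCoeffNat, ← Nat.range_succ_eq_Iic]
  refine (map_sum PadicInt.Coe.ringHom _ _).trans ?_
  refine Finset.sum_congr rfl fun m _ => ?_
  have hiff : ‖(m : ℤ_[p]) - (c : ℤ_[p])‖ ≤ (p : ℝ) ^ (-s : ℤ) ↔ m % p ^ s = c := by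
    have h := PadicInt.norm_int_le_pow_iff_dvd (p := p) (k := (m : ℤ) - c) (n := s)
    push_cast at h
    rw [h, ← Nat.cast_pow, ← Nat.modEq_iff_dvd, Nat.ModEq, Nat.mod_eq_of_lt hc, eq_comm]
  have hf : (f (m : ℤ_[p]) : ℚ_[p]) = residueIndicator p s c m := by
    have hmem : (m : ℤ_[p]) ∈ Metric.closedBall (c : ℤ_[p]) ((p : ℝ) ^ (-s : ℤ)) ↔
        m % p ^ s = c := by rw [Metric.mem_closedBall, dist_eq_norm, hiff]
    rw [residueIndicator]
    split_ifs with h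
    · have : f (m : ℤ_[p]) = 1 := Set.indicator_of_mem (hmem.2 h) fun _ => 1
      rw [this, PadicInt.coe_one]
    · have : f (m : ℤ_[p]) = 0 := Set.indicator_of_notMem (mt hmem.1 h) fun _ => 1
      rw [this, PadicInt.coe_zero]
  rw [← hf, map_zsmul, zero_add, nsmul_eq_mul, mul_one]
  rfl

variable {E : Type*} [AddCommGroup E] [Module ℚ_[p] E] [UniformSpace E] [IsUniformAddGroup E]
  [ContinuousSMul ℚ_[p] E]

theorem tendsto_newtonCoeff {κ : Type*} [Fintype κ] [DecidableEq κ] {G : (κ → ℤ_[p]) → E}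
    (hG : Continuous G) (q : ContUltraSeminorm ℚ_[p] E) :
    Tendsto (fun ν => q.1 (newtonCoeff (fun μ => G fun i => (μ i : ℤ_[p])) ν)) cofinite (𝓝 0) := by
  refine tendsto_order.2 ⟨fun a ha => Eventually.of_forall fun ν =>
    ha.trans_le (apply_nonneg _ _), fun ε hε => ?_⟩
  have hp1 : 1 < (p : ℝ) := by exact_mod_cast (Fact.out : p.Prime).one_lt
  obtain ⟨δ, hδ, hGδ⟩ := Metric.uniformity_basis_dist.mem_iff.1
    (CompactSpace.uniformContinuous_of_continuous hG
      (seminorm_lt_mem_uniformity q.2.1 (half_pos hε)))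
  obtain ⟨s, hs⟩ : ∃ s : ℕ, (p : ℝ) ^ (-s : ℤ) < δ := by
    obtain ⟨s, hs⟩ := exists_pow_lt_of_lt_one hδ (inv_lt_one_of_one_lt₀ hp1)
    exact ⟨s, by rwa [zpow_neg, zpow_natCast, ← inv_pow]⟩
  let C : Finset (κ → ℕ) := Fintype.piFinset fun _ => Finset.range (p ^ s)
  let G₁ : (κ → ℕ) → E := fun μ =>
    G (fun i => (μ i : ℤ_[p])) - G fun i => ((μ i % p ^ s : ℕ) : ℤ_[p])
  let G₂ : (κ → ℕ) → (κ → ℕ) → E := fun c μ =>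
    (∏ i, residueIndicator p s (c i) (μ i)) • G fun i => (c i : ℤ_[p])
  -- `G` is a uniformly small remainder `G₁` (the index `none`) plus a function of the residues
  -- modulo `p ^ s`, written as a finite sum of products of one-variable indicators `G₂ c`.
  have hdecomp : (fun μ : κ → ℕ => G fun i => (μ i : ℤ_[p])) = fun μ =>
      ∑ c ∈ insert none (C.map Function.Embedding.some), c.elim (G₁ μ) fun c => G₂ c μ := by
    funext μ
    rw [Finset.sum_insert (by simp), Finset.sum_map]
    simp only [Option.elim, Function.Embedding.some_apply, G₁, G₂]
    rw [Finset.sum_eq_single (fun i => μ i % p ^ s)]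
    · simp [residueIndicator]
    · intro c _ hc
      obtain ⟨i, hi⟩ := Function.ne_iff.1 hc
      rw [Finset.prod_eq_zero (Finset.mem_univ i) (by simp [residueIndicator, Ne.symm hi]), zero_smul]
    · intro h
      exact absurd (Fintype.mem_piFinset.2 fun i =>
        Finset.mem_range.2 (Nat.mod_lt _ (pow_pos (Fact.out : p.Prime).pos s))) h
  have hG₁ : ∀ ν, q.1 (newtonCoeff G₁ ν) ≤ ε / 2 := by
    refine seminorm_newtonCoeff_le q.2.2 fun μ => le_of_lt ?_
    refine hGδ (a := (fun i => ((μ i % p ^ s : ℕ) : ℤ_[p]), fun i => (μ i : ℤ_[p]))) ?_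
    refine (dist_pi_lt_iff hδ).2 fun i => ?_
    rw [dist_comm, dist_eq_norm]
    exact (norm_natCast_mod_le s (μ i)).trans_lt hs
  have hG₂ : ∀ c ∈ C, Tendsto (fun ν => q.1 (newtonCoeff (G₂ c) ν)) cofinite (𝓝 0) := by
    intro c hc
    have h1 := (tendsto_prod_cofinite (fun i n => norm_nonneg _)
      (fun i n => norm_newtonCoeffNat_residueIndicator_le s (c i) n) fun i =>
        tendsto_zero_iff_norm_tendsto_zero.1 (tendsto_newtonCoeffNat_residueIndicator (p := p)
          (Finset.mem_range.1 (Fintype.mem_piFinset.1 hc i)))).mul_const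
            (q.1 (G fun i => (c i : ℤ_[p])))
    rw [zero_mul] at h1
    refine h1.congr fun ν => ?_
    rw [newtonCoeff_smul_const, newtonCoeff_prod, map_smul_eq_mul, norm_prod]
  have hev : ∀ᶠ ν in cofinite, ∀ c ∈ C, q.1 (newtonCoeff (G₂ c) ν) < ε / 2 :=
    (Filter.eventually_all_finset C).2 fun c hc =>
      (hG₂ c hc).eventually (gt_mem_nhds (half_pos hε))
  filter_upwards [hev] with ν hν
  rw [hdecomp, newtonCoeff_finset_sum]
  refine lt_of_le_of_lt (q.2.2.seminorm_sum_le (half_pos hε).le fun c hc => ?_) (half_lt_self hε)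
  rw [Finset.mem_insert, Finset.mem_map] at hc
  rcases hc with rfl | ⟨c, hc, rfl⟩
  · exact hG₁ ν
  · exact (hν c hc).le

end Decay

/-! ### Products of divided differences and their series -/

section Series

variable {p : ℕ} [Fact p.Prime] {ι : Type*}

/-- The point of `ℤ_p^ι ⊆ ℚ_p^ι` given by a tuple of `p`-adic integers. -/
def cubeOfInt (x : ι → ℤ_[p]) : zpCube p ι := ⟨fun i => x i, fun i => (x i).2⟩

lemma continuous_cubeOfInt : Continuous (cubeOfInt : (ι → ℤ_[p]) → zpCube p ι) :=
  Continuous.subtype_mk (continuous_pi fun i => continuous_subtype_val.comp (continuous_apply i)) _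

/-- The tuple of `p`-adic integers given by a point of `ℤ_p^ι ⊆ ℚ_p^ι`. -/
def intOfCube (x : zpCube p ι) (i : ι) : ℤ_[p] := ⟨x.1 i, x.2 i⟩

lemma continuous_intOfCube : Continuous (intOfCube : zpCube p ι → ι → ℤ_[p]) :=
  continuous_pi fun i => ((continuous_apply i).comp continuous_subtype_val).subtype_mk _

/-- The point of `(ℤ_p^ι)^{<β>}` given by tuples of `p`-adic integers. -/
def extOfInt (β : ι → ℕ) (x : ∀ i, Fin (β i + 1) → ℤ_[p]) : extDom (zpCube p ι) β :=
  ⟨fun i j => x i j, fun j i => (x i (j i)).2⟩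

lemma continuous_extOfInt (β : ι → ℕ) : Continuous (extOfInt (p := p) β) :=
  Continuous.subtype_mk (continuous_pi fun i => continuous_pi fun j =>
    continuous_subtype_val.comp ((continuous_apply j).comp (continuous_apply i))) _

lemma norm_le_one_of_mem_extDom [DecidableEq ι] {V : Set (ι → ℚ_[p])} (hV : V ⊆ zpCube p ι) {β : ι → ℕ}
    (x : extDom V β) (i : ι) (j : Fin (β i + 1)) : ‖x.1 i j‖ ≤ 1 := by
  simpa using hV (x.2 (Function.update (fun _ => 0) i j)) i

/-- The tuples of `p`-adic integers given by a point of `V^{<β>}`, where `V ⊆ ℤ_p^ι`. -/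
def intOfExt [DecidableEq ι] {V : Set (ι → ℚ_[p])} (hV : V ⊆ zpCube p ι) (β : ι → ℕ)
    (x : extDom V β) (i : ι) (j : Fin (β i + 1)) : ℤ_[p] :=
  ⟨x.1 i j, norm_le_one_of_mem_extDom hV x i j⟩

lemma continuous_intOfExt [DecidableEq ι] {V : Set (ι → ℚ_[p])} (hV : V ⊆ zpCube p ι)
    (β : ι → ℕ) : Continuous (intOfExt hV β) :=
  continuous_pi fun i => continuous_pi fun j => by
    have h : Continuous fun x : extDom V β => x.1 i j :=
      (continuous_apply j).comp ((continuous_apply i).comp continuous_subtype_val)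
    exact h.subtype_mk _

/-- Compactness makes the compact-open topology on functions on this domain that of uniform
convergence. -/
instance [Fintype ι] [DecidableEq ι] (β : ι → ℕ) : CompactSpace (extDom (zpCube p ι) β) := by
  have : Function.Surjective (extOfInt (p := p) β) := fun x => ⟨intOfExt Subset.rfl β x, rfl⟩
  exact this.compactSpace (continuous_extOfInt β)

variable [Fintype ι]

/-- The function `binom(x, ν) = ∏ i, binom(x_i, ν_i)`. -/
def chooseProd (x : ι → ℤ_[p]) (ν : ι → ℕ) : ℚ_[p] := ∏ i, (Ring.choose (x i) (ν i) : ℤ_[p])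

/-- The continuous extension of the partial difference quotient of order `β` of `binom(·, ν)`. -/
def ddProd (β ν : ι → ℕ) (x : ∀ i, Fin (β i + 1) → ℤ_[p]) : ℚ_[p] :=
  ∏ i, ddChoose (β i) (ν i) 0 (x i)

lemma chooseProd_natCast (μ ν : ι → ℕ) :
    chooseProd (p := p) (fun i => (μ i : ℤ_[p])) ν = ∏ i, ((μ i).choose (ν i) : ℚ_[p]) := by
  simp [chooseProd, Ring.choose_natCast]

lemma chooseProd_eq_ddProd (x : ι → ℤ_[p]) (ν : ι → ℕ) :
    chooseProd x ν = ddProd 0 ν fun i _ => x i := by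
  simp [chooseProd, ddProd, ddChoose]

lemma continuous_ddProd (β ν : ι → ℕ) : Continuous (ddProd (p := p) β ν) :=
  continuous_finsetProd _ fun i _ => (continuous_ddChoose (β i) (ν i)).comp
    (continuous_const.prodMk (continuous_apply i))

lemma norm_ddProd_le (β ν : ι → ℕ) (x : ∀ i, Fin (β i + 1) → ℤ_[p]) :
    ‖ddProd β ν x‖ ≤ (monomialWeight β ν : ℝ) := by
  rw [ddProd, norm_prod, monomialWeight]
  push_cast
  exact Finset.prod_le_prod (fun i _ => norm_nonneg _) fun i _ => norm_ddChoose_le _ _ _ _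

lemma sum_prod_nodal_inv_mul_chooseProd [DecidableEq ι] (β ν : ι → ℕ) {x : ∀ i, Fin (β i + 1) → ℤ_[p]}
    (hx : ∀ i, Function.Injective (x i)) :
    ∑ j : ∀ i, Fin (β i + 1),
      (∏ i, ∏ k ∈ Finset.univ.erase (j i), ((x i (j i) : ℚ_[p]) - x i k)⁻¹) *
        chooseProd (fun i => x i (j i)) ν = ddProd β ν x := by
  simp only [ddProd, ← sum_nodal_inv_mul_choose _ _ _ (hx _), sub_zero]
  rw [Finset.prod_univ_sum, Fintype.piFinset_univ]
  simp only [Finset.prod_mul_distrib, chooseProd]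

variable {E : Type*} [AddCommGroup E] [Module ℚ_[p] E]

lemma ContUltraSeminorm.sub_le [TopologicalSpace E] (q : ContUltraSeminorm ℚ_[p] E) (x y : E) :
    q.1 (x - y) ≤ max (q.1 x) (q.1 y) := by
  rw [sub_eq_add_neg, ← map_neg_eq_map q.1 y]
  exact q.2.2 _ _

variable [UniformSpace E] [IsUniformAddGroup E] [ContinuousSMul ℚ_[p] E]

lemma summable_smul (hE : IsUltraLocallyConvex ℚ_[p] E)
    (hseq : ∀ u : ℕ → E, CauchySeq u → ∃ x, Tendsto u atTop (𝓝 x)) {Y : Type*} [Countable Y]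
    {c : Y → ℚ_[p]} {w : Y → ℝ} (hw : ∀ y, ‖c y‖ ≤ w y) {b : Y → E}
    (hb : ∀ q : ContUltraSeminorm ℚ_[p] E, Tendsto (fun y => w y * q.1 (b y)) cofinite (𝓝 0)) :
    Summable fun y => c y • b y := by
  refine hE.summable hseq fun q => squeeze_zero (fun _ => apply_nonneg _ _) (fun y => ?_) (hb q)
  rw [map_smul_eq_mul]
  exact mul_le_mul_of_nonneg_right (hw y) (apply_nonneg _ _)

/-- Only finitely many terms can exceed `ε / 2` in `q`; continuity controls those near `x₀`, and the
ultrametric inequality the others, uniformly in `x`. -/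
lemma continuous_tsum_smul [T2Space E] (hE : IsUltraLocallyConvex ℚ_[p] E)
    (hseq : ∀ u : ℕ → E, CauchySeq u → ∃ x, Tendsto u atTop (𝓝 x)) {X Y : Type*} [Countable Y]
    [TopologicalSpace X] {c : Y → X → ℚ_[p]} (hc : ∀ y, Continuous (c y)) {w : Y → ℝ}
    (hw : ∀ y x, ‖c y x‖ ≤ w y) {b : Y → E}
    (hb : ∀ q : ContUltraSeminorm ℚ_[p] E, Tendsto (fun y => w y * q.1 (b y)) cofinite (𝓝 0)) :
    Continuous fun x => ∑' y, c y x • b y := by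
  refine continuous_iff_continuousAt.2 fun x₀ => hE.tendsto_nhds fun q ε hε => ?_
  have hfin : {y | ¬ w y * q.1 (b y) < ε / 2}.Finite :=
    (hb q).eventually (gt_mem_nhds (half_pos hε))
  have hev : ∀ᶠ x in 𝓝 x₀, ∀ y ∈ hfin.toFinset, q.1 (c y x • b y - c y x₀ • b y) < ε / 2 := by
    refine (Filter.eventually_all_finset _).2 fun y _ => ?_
    have h : Continuous fun x => q.1 (c y x • b y - c y x₀ • b y) :=
      q.2.1.comp (((hc y).smul continuous_const).sub continuous_const)
    exact (h.tendsto x₀).eventually (gt_mem_nhds (by simpa using half_pos hε))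
  filter_upwards [hev] with x hx
  have hsum : ∀ x, HasSum (fun y => c y x • b y) (∑' y, c y x • b y) := fun x =>
    (summable_smul hE hseq (fun y => hw y x) hb).hasSum
  refine lt_of_le_of_lt (q.hasSum_le ((hsum x).sub (hsum x₀)) (half_pos hε).le fun y => ?_)
    (half_lt_self hε)
  by_cases hy : w y * q.1 (b y) < ε / 2
  · refine (q.sub_le _ _).trans (max_le ?_ ?_) <;>
    · rw [map_smul_eq_mul]
      exact (mul_le_mul_of_nonneg_right (hw y _) (apply_nonneg _ _)).trans hy.le
  · exact (hx y (hfin.mem_toFinset.2 hy)).le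

/-- The series `∑_ν binom(x, ν) b_ν`. -/
def mahlerSum (b : (ι → ℕ) → E) (x : zpCube p ι) : E := ∑' ν, chooseProd (intOfCube x) ν • b ν

/-- The series `∑_ν binom(·, ν)^{<β>}(x) b_ν`. -/
def ddSum (b : (ι → ℕ) → E) (β : ι → ℕ) (x : ∀ i, Fin (β i + 1) → ℤ_[p]) : E :=
  ∑' ν, ddProd β ν x • b ν

lemma continuous_ddSum [T2Space E] (hE : IsUltraLocallyConvex ℚ_[p] E)
    (hseq : ∀ u : ℕ → E, CauchySeq u → ∃ x, Tendsto u atTop (𝓝 x)) {b : (ι → ℕ) → E} {β : ι → ℕ}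
    (hb : ∀ q : ContUltraSeminorm ℚ_[p] E,
      Tendsto (fun ν => (monomialWeight β ν : ℝ) * q.1 (b ν)) cofinite (𝓝 0)) :
    Continuous (ddSum (p := p) b β) :=
  continuous_tsum_smul hE hseq (continuous_ddProd β) (norm_ddProd_le β) hb

lemma norm_chooseProd_le (x : ι → ℤ_[p]) (ν : ι → ℕ) :
    ‖chooseProd x ν‖ ≤ (monomialWeight 0 ν : ℝ) := by
  rw [chooseProd_eq_ddProd]; exact norm_ddProd_le _ _ _

lemma continuous_mahlerSum [T2Space E] (hE : IsUltraLocallyConvex ℚ_[p] E)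
    (hseq : ∀ u : ℕ → E, CauchySeq u → ∃ x, Tendsto u atTop (𝓝 x)) {b : (ι → ℕ) → E}
    (hb : ∀ q : ContUltraSeminorm ℚ_[p] E,
      Tendsto (fun ν => (monomialWeight 0 ν : ℝ) * q.1 (b ν)) cofinite (𝓝 0)) :
    Continuous (mahlerSum (p := p) b) := by
  have h : mahlerSum (p := p) b = fun x => ddSum b 0 fun i _ => intOfCube x i := by
    funext x
    simp only [mahlerSum, ddSum, chooseProd_eq_ddProd]
  rw [h]
  exact (continuous_ddSum hE hseq hb).comp (continuous_pi fun i => continuous_pi fun _ =>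
    (continuous_apply i).comp continuous_intOfCube)

lemma diffQuot_mahlerSum [T2Space E] [DecidableEq ι] (hE : IsUltraLocallyConvex ℚ_[p] E)
    (hseq : ∀ u : ℕ → E, CauchySeq u → ∃ x, Tendsto u atTop (𝓝 x)) {b : (ι → ℕ) → E}
    (hb : ∀ q : ContUltraSeminorm ℚ_[p] E,
      Tendsto (fun ν => (monomialWeight 0 ν : ℝ) * q.1 (b ν)) cofinite (𝓝 0))
    {V : Set (ι → ℚ_[p])} (hV : V ⊆ zpCube p ι) (β : ι → ℕ) (x : diffDom V β) :
    diffQuot (mahlerSum b ∘ Set.inclusion hV) β x = ddSum b β (intOfExt hV β x.1) := by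
  have hx : ∀ i, Function.Injective (intOfExt hV β x.1 i) := fun i j k h =>
    x.2 i (congrArg Subtype.val h)
  have h1 : ∀ j : ∀ i, Fin (β i + 1), HasSum (fun ν =>
      (∏ i, ∏ k ∈ Finset.univ.erase (j i), (x.1.1 i (j i) - x.1.1 i k)⁻¹) •
        (chooseProd (fun i => intOfExt hV β x.1 i (j i)) ν • b ν))
      ((∏ i, ∏ k ∈ Finset.univ.erase (j i), (x.1.1 i (j i) - x.1.1 i k)⁻¹) •
        (mahlerSum b ∘ Set.inclusion hV) ⟨fun i => x.1.1 i (j i), x.1.2 j⟩) := fun j =>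
    (summable_smul hE hseq (norm_chooseProd_le _) hb).hasSum.const_smul _
  have h2 := hasSum_sum (s := Finset.univ) fun j _ => h1 j
  refine (h2.tsum_eq.symm.trans ?_)
  refine tsum_congr fun ν => ?_
  simp only [smul_smul, ← Finset.sum_smul]
  rw [← sum_prod_nodal_inv_mul_chooseProd β ν hx]
  rfl

lemma mahlerSum_natCast [DecidableEq ι] (b : (ι → ℕ) → E) {μ B : ι → ℕ} (hB : μ ≤ B) :
    mahlerSum b ⟨_, natCast_mem_zpCube p μ⟩ =
      ∑ ν ∈ Finset.Iic B, (∏ i, ((μ i).choose (ν i) : ℚ_[p])) • b ν := by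
  have h : intOfCube ⟨_, natCast_mem_zpCube p μ⟩ = fun i => (μ i : ℤ_[p]) := by
    funext i; exact Subtype.ext (PadicInt.coe_natCast (p := p) (μ i)).symm
  rw [mahlerSum, h]
  simp only [chooseProd_natCast]
  refine tsum_eq_sum fun ν hν => ?_
  obtain ⟨i, hi⟩ : ∃ i, B i < ν i := by
    by_contra! h
    exact hν (Finset.mem_Iic.2 h)
  rw [Finset.prod_eq_zero (Finset.mem_univ i)
    (by rw [Nat.choose_eq_zero_of_lt ((hB i).trans_lt hi), Nat.cast_zero]), zero_smul]

/-- Mahler coefficients involve only values at points of `ℕ^ι`, where the series is a finite sum; no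
decay of `b` is needed. -/
lemma mahlerCoeff_mahlerSum [DecidableEq ι] (b : (ι → ℕ) → E) :
    mahlerCoeff (mahlerSum (p := p) b) = b := by
  funext l
  rw [mahlerCoeff_eq_newtonCoeff, newtonCoeff_congr fun μ hμ => mahlerSum_natCast (p := p) b hμ,
    newtonCoeff_finset_sum]
  simp only [newtonCoeff_smul_const, newtonCoeff_choose]
  simp

/-- Both sides are continuous and agree on the dense set `ℕ^ι` by Newton's expansion. -/
lemma mahlerSum_mahlerCoeff [T2Space E] [DecidableEq ι] (hE : IsUltraLocallyConvex ℚ_[p] E)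
    (hseq : ∀ u : ℕ → E, CauchySeq u → ∃ x, Tendsto u atTop (𝓝 x)) {f : zpCube p ι → E}
    (hf : Continuous f) (hb : ∀ q : ContUltraSeminorm ℚ_[p] E,
      Tendsto (fun ν => (monomialWeight 0 ν : ℝ) * q.1 (mahlerCoeff f ν)) cofinite (𝓝 0)) :
    mahlerSum (mahlerCoeff f) = f := by
  have hd : DenseRange fun μ : ι → ℕ => fun i => (μ i : ℤ_[p]) :=
    DenseRange.piMap fun _ => PadicInt.denseRange_natCast
  have h := hd.equalizer ((continuous_mahlerSum hE hseq hb).comp continuous_cubeOfInt)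
    (hf.comp continuous_cubeOfInt) (by
      funext μ
      have hμ : cubeOfInt (fun i => (μ i : ℤ_[p])) = ⟨_, natCast_mem_zpCube p μ⟩ :=
        Subtype.ext (funext fun i => PadicInt.coe_natCast (p := p) (μ i))
      simp only [Function.comp_apply, hμ]
      rw [mahlerSum_natCast _ le_rfl,
        ← sum_choose_smul_newtonCoeff (fun μ => f ⟨_, natCast_mem_zpCube p μ⟩) (le_refl μ)]
      refine Finset.sum_congr rfl fun ν _ => ?_
      rw [mahlerCoeff_eq_newtonCoeff, ← Int.cast_smul_eq_zsmul ℚ_[p]]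
      push_cast
      rfl)
  funext x
  exact congrFun h (intOfCube x)

end Series

/-! ### Estimates for Newton coefficients of differentiable functions -/

section CoefficientEstimates

lemma nodes_le (r c : ℕ) (k : Fin (r + 1) → ℕ) (j : Fin (r + 1)) :
    nodes r c k j ≤ c + (∑ s, k s + r) := by
  induction r generalizing c with
  | zero => simp [nodes]
  | succ r ih =>
    rw [Fin.sum_univ_succ k]
    refine Fin.cases ?_ (fun j => ?_) j
    · simp only [nodes, Fin.cons_zero]; omega
    · simp only [nodes, Fin.cons_succ]
      have := ih (c + k 0 + 1) (Fin.tail k) j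
      simp only [Fin.tail] at this
      omega

lemma nodeDenom_const (r m : ℕ) : nodeDenom r (fun _ => m) = r.factorial * (m + 1) ^ r := by
  induction r with
  | zero => simp [nodeDenom]
  | succ r ih =>
    have : Fin.tail (fun _ : Fin (r + 1 + 1) => m) = fun _ => m := rfl
    rw [nodeDenom, this, ih, Nat.factorial_succ, pow_succ]
    simp only [Finset.sum_const, Finset.card_fin, smul_eq_mul]
    ring

variable {p : ℕ} [Fact p.Prime]

/-- The denominator is a product of tail sums of the numbers `i_s + 1`, `s ≥ 1`. Setting all of
these equal to `p ^ e` makes every factor divisible by `p ^ e`. -/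
lemma exists_pow_le_norm_nodeDenom_inv (p : ℕ) [Fact p.Prime] (r n : ℕ) :
    ∃ r' ≤ r, ∃ i : Fin (r' + 1) → ℕ, ∑ s, i s + r' = n ∧
      (n : ℝ) ^ r ≤ ((r * p : ℕ) : ℝ) ^ r * ‖(nodeDenom r' i : ℚ_[p])‖⁻¹ := by
  have hp : 1 < p := (Fact.out : p.Prime).one_lt
  rcases lt_or_ge n r with hn | hn
  -- For `n < r` there is no room for `r + 1` nodes; order 0 suffices, as `n ^ r` is bounded by the
  -- constant.
  · refine ⟨0, Nat.zero_le _, fun _ => n, by simp, ?_⟩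
    simp only [nodeDenom, Nat.cast_one, norm_one, inv_one, mul_one]
    gcongr
    nlinarith
  rcases r with _ | s
  · exact ⟨0, le_rfl, fun _ => n, by simp, by simp [nodeDenom]⟩
  have hdiv : n / (s + 1) ≠ 0 := (Nat.div_pos hn s.succ_pos).ne'
  set e := Nat.log p (n / (s + 1))
  have h1 : p ^ e * (s + 1) ≤ n := (Nat.le_div_iff_mul_le s.succ_pos).1 (Nat.pow_log_le_self p hdiv)
  have h2 : n < p ^ (e + 1) * (s + 1) :=
    (Nat.div_lt_iff_lt_mul s.succ_pos).1 (Nat.lt_pow_succ_log_self hp _)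
  obtain ⟨m, hm⟩ : ∃ m, p ^ e = m + 1 :=
    ⟨p ^ e - 1, (Nat.sub_add_cancel (Nat.pow_pos (zero_lt_one.trans hp))).symm⟩
  refine ⟨s + 1, le_rfl, Fin.cons (n - (m + 1) * (s + 1)) fun _ => m, ?_, ?_⟩
  · rw [hm] at h1
    rw [Fin.sum_univ_succ]
    simp only [Fin.cons_zero, Fin.cons_succ, Finset.sum_const, Finset.card_fin, smul_eq_mul]
    have : (m + 1) * (s + 1) = (s + 1) * m + (s + 1) := by ring
    omega
  · have hden : nodeDenom (s + 1) (Fin.cons (n - (m + 1) * (s + 1)) fun _ => m) =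
        (s + 1).factorial * (p ^ e) ^ (s + 1) := by
      rw [hm, ← nodeDenom_const]
      rfl
    have hf : ‖((s + 1).factorial : ℚ_[p])‖ ≤ 1 := by
      simpa using Padic.norm_int_le_one (p := p) ((s + 1).factorial : ℤ)
    have hf0 : 0 < ‖((s + 1).factorial : ℚ_[p])‖ :=
      norm_pos_iff.2 (Nat.cast_ne_zero.2 (Nat.factorial_ne_zero _))
    rw [hden]
    push_cast
    simp only [norm_mul, norm_pow, Padic.norm_p, mul_inv, inv_pow, inv_inv]
    have h3 : (n : ℝ) ≤ ((s : ℝ) + 1) * p * p ^ e := by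
      have : (n : ℝ) ≤ ((p ^ (e + 1) * (s + 1) : ℕ) : ℝ) := by exact_mod_cast h2.le
      refine this.trans (le_of_eq ?_)
      push_cast
      ring
    calc (n : ℝ) ^ (s + 1) ≤ (((s : ℝ) + 1) * p * p ^ e) ^ (s + 1) := by gcongr
      _ = (((s : ℝ) + 1) * p) ^ (s + 1) * (1 * ((p : ℝ) ^ e) ^ (s + 1)) := by
        rw [mul_pow (((s : ℝ) + 1) * p), one_mul]
      _ ≤ _ := by
        gcongr
        exact (one_le_inv₀ hf0).2 hf

variable {ι : Type*} [Fintype ι]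

/-- The constant in the comparison of monomial weights and Newton coefficients. -/
def weightConst (p : ℕ) (β : ι → ℕ) : ℝ := ∏ i, ((β i * p : ℕ) : ℝ) ^ β i

lemma weightConst_nonneg (p : ℕ) (β : ι → ℕ) : 0 ≤ weightConst p β :=
  Finset.prod_nonneg fun _ _ => by positivity

lemma exists_monomialWeight_le (p : ℕ) [Fact p.Prime] (β ν : ι → ℕ) :
    ∃ β' ≤ β, ∃ k : (Σ i, Fin (β' i + 1)) → ℕ, (∀ i, ∑ s, k ⟨i, s⟩ + β' i = ν i) ∧
      (monomialWeight β ν : ℝ) ≤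
        weightConst p β * ‖(∏ i, (nodeDenom (β' i) fun s => k ⟨i, s⟩ : ℚ_[p]))⁻¹‖ := by
  choose β' hβ' k hk hle using fun i => exists_pow_le_norm_nodeDenom_inv p (β i) (ν i)
  refine ⟨β', hβ', fun t => k t.1 t.2, hk, ?_⟩
  rw [norm_inv, norm_prod, ← Finset.prod_inv_distrib, weightConst, ← Finset.prod_mul_distrib,
    monomialWeight]
  push_cast
  exact Finset.prod_le_prod (fun i _ => by positivity) fun i _ => by simpa using hle i

variable [DecidableEq ι] {E : Type*} [AddCommGroup E] [Module ℚ_[p] E] [UniformSpace E]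
  [IsUniformAddGroup E] [ContinuousSMul ℚ_[p] E]

/-- The parametrization of `(ℤ_p^ι)^{<β>}` by `ℤ_p^{∑ i, (β i + 1)}` in terms of nodes. -/
def extOfNodes (β : ι → ℕ) (z : (Σ i, Fin (β i + 1)) → ℤ_[p]) : extDom (zpCube p ι) β :=
  extOfInt β fun i => nodes (β i) 0 fun s => z ⟨i, s⟩

lemma continuous_extOfNodes (β : ι → ℕ) : Continuous (extOfNodes (p := p) β) :=
  (continuous_extOfInt β).comp (continuous_pi fun i => by
    have h : Continuous fun z : (Σ i, Fin (β i + 1)) → ℤ_[p] =>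
        ((0 : ℤ_[p]), fun s => z ⟨i, s⟩) := by fun_prop
    exact (continuous_nodes (β i)).comp h)

lemma newtonCoeff_extOfNodes {f : zpCube p ι → E} {β : ι → ℕ} {g : C(extDom (zpCube p ι) β, E)}
    (hg : IsDiffExt f β g) (k : (Σ i, Fin (β i + 1)) → ℕ) :
    newtonCoeff (fun μ => g (extOfNodes β fun t => (μ t : ℤ_[p]))) k =
      (∏ i, (nodeDenom (β i) fun s => k ⟨i, s⟩ : ℚ_[p]))⁻¹ •
        mahlerCoeff f fun i => ∑ s, k ⟨i, s⟩ + β i := by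
  set B : ι → ℕ := fun i => ∑ s, k ⟨i, s⟩ + β i with hB
  have h1 : ∀ μ ≤ k, g (extOfNodes β fun t => (μ t : ℤ_[p])) =
      ∑ ν ∈ Finset.Iic B, (∏ i, ddChooseNodes p (β i) (ν i) fun s => μ ⟨i, s⟩) •
        mahlerCoeff f ν := by
    intro μ hμ
    let N : ∀ i, Fin (β i + 1) → ℕ := fun i => nodes (β i) 0 fun s => μ ⟨i, s⟩
    let y : ∀ i, Fin (β i + 1) → ℤ_[p] := fun i => nodes (β i) 0 fun s => (μ ⟨i, s⟩ : ℤ_[p])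
    have hy : ∀ i j, y i j = (N i j : ℤ_[p]) := fun i j => by
      rw [← nodes_natCast]; simp [y]
    have hinj : ∀ i, Function.Injective (y i) := fun i a b hab => by
      rw [hy, hy] at hab
      exact nodes_injective _ _ _ (Nat.cast_injective hab)
    have hx : extOfNodes β (fun t => (μ t : ℤ_[p])) ∈ diffDom (zpCube p ι) β :=
      fun i => Subtype.val_injective.comp (hinj i)
    -- All nodes stay below `B`, so the Newton expansions of `f` there run over the same finite box.
    have hN : ∀ j : ∀ i, Fin (β i + 1), (fun i => N i (j i)) ≤ B := fun j i =>
      (nodes_le _ _ _ _).trans (by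
        simp only [hB, zero_add]
        gcongr
        exact hμ _)
    have hfN : ∀ j : ∀ i, Fin (β i + 1),
        f ⟨fun i => (y i (j i) : ℚ_[p]), fun i => (y i (j i)).2⟩ =
          ∑ ν ∈ Finset.Iic B, chooseProd (fun i => y i (j i)) ν • mahlerCoeff f ν := by
      intro j
      have e1 : (⟨fun i => (y i (j i) : ℚ_[p]), fun i => (y i (j i)).2⟩ : zpCube p ι) =
          ⟨_, natCast_mem_zpCube p fun i => N i (j i)⟩ :=
        Subtype.ext (funext fun i => by
          change ((y i (j i) : ℤ_[p]) : ℚ_[p]) = _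
          rw [hy, PadicInt.coe_natCast])
      rw [e1, ← sum_choose_smul_newtonCoeff (fun μ => f ⟨_, natCast_mem_zpCube p μ⟩) (hN j)]
      refine Finset.sum_congr rfl fun ν _ => ?_
      simp only [hy]
      rw [chooseProd_natCast, mahlerCoeff_eq_newtonCoeff, ← Int.cast_smul_eq_zsmul ℚ_[p]]
      push_cast
      rfl
    have h2 : g (extOfNodes β fun t => (μ t : ℤ_[p])) = ∑ j : ∀ i, Fin (β i + 1),
        (∏ i, ∏ l ∈ Finset.univ.erase (j i), ((y i (j i) : ℚ_[p]) - y i l)⁻¹) •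
          f ⟨fun i => (y i (j i) : ℚ_[p]), fun i => (y i (j i)).2⟩ := hg ⟨_, hx⟩
    rw [h2]
    simp only [hfN, Finset.smul_sum, smul_smul]
    rw [Finset.sum_comm]
    refine Finset.sum_congr rfl fun ν _ => ?_
    rw [← Finset.sum_smul, sum_prod_nodal_inv_mul_chooseProd β ν hinj]
    congr 1
    refine Finset.prod_congr rfl fun i _ => ?_
    have := ddChoose_nodes (p := p) (β i) (ν i) 0 fun s => μ ⟨i, s⟩
    rwa [Nat.cast_zero] at this
  rw [newtonCoeff_congr h1, newtonCoeff_finset_sum]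
  simp only [newtonCoeff_smul_const]
  have h3 : ∀ ν : ι → ℕ, newtonCoeff (fun μ : (Σ i, Fin (β i + 1)) → ℕ =>
      ∏ i, ddChooseNodes p (β i) (ν i) fun s => μ ⟨i, s⟩) k =
      if B = ν then (∏ i, (nodeDenom (β i) fun s => k ⟨i, s⟩ : ℚ_[p]))⁻¹ else 0 := by
    intro ν
    rw [newtonCoeff_sigma fun i => ddChooseNodes p (β i) (ν i)]
    simp only [newtonCoeff_ddChooseNodes, Finset.prod_ite_zero, Finset.mem_univ, true_implies,
      Finset.prod_inv_distrib, funext_iff, hB]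
  simp [h3]

lemma exists_weight_mul_mahlerCoeff_le {f : zpCube p ι → E} (β : ι → ℕ)
    (g : ∀ β' ≤ β, C(extDom (zpCube p ι) β', E)) (hg : ∀ β' h, IsDiffExt f β' (g β' h))
    (q : ContUltraSeminorm ℚ_[p] E) (ν : ι → ℕ) :
    ∃ (β' : ι → ℕ) (h : β' ≤ β) (k : (Σ i, Fin (β' i + 1)) → ℕ),
      (∀ i, ∑ s, k ⟨i, s⟩ + β' i = ν i) ∧ (monomialWeight β ν : ℝ) * q.1 (mahlerCoeff f ν) ≤
        weightConst p β *
          q.1 (newtonCoeff (fun μ => g β' h (extOfNodes β' fun t => (μ t : ℤ_[p]))) k) := by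
  obtain ⟨β', h, k, hk, hle⟩ := exists_monomialWeight_le p β ν
  refine ⟨β', h, k, hk, ?_⟩
  rw [newtonCoeff_extOfNodes (hg β' h), map_smul_eq_mul, ← mul_assoc, funext hk]
  exact mul_le_mul_of_nonneg_right hle (apply_nonneg _ _)

theorem tendsto_weight_mul_mahlerCoeff {f : zpCube p ι → E} (β : ι → ℕ)
    (hf : ∀ β' ≤ β, ∃ g : C(extDom (zpCube p ι) β', E), IsDiffExt f β' g)
    (q : ContUltraSeminorm ℚ_[p] E) :
    Tendsto (fun ν => (monomialWeight β ν : ℝ) * q.1 (mahlerCoeff f ν)) cofinite (𝓝 0) := by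
  choose g hg using hf
  refine tendsto_order.2 ⟨fun a ha => Eventually.of_forall fun ν => ha.trans_le (by positivity),
    fun ε hε => ?_⟩
  have hfin : ∀ (β' : ι → ℕ) (h : β' ≤ β), {k : (Σ i, Fin (β' i + 1)) → ℕ | ¬ weightConst p β *
      q.1 (newtonCoeff (fun μ => g β' h (extOfNodes β' fun t => (μ t : ℤ_[p]))) k) < ε}.Finite := by
    intro β' h
    have := (tendsto_newtonCoeff ((g β' h).continuous.comp (continuous_extOfNodes β')) q).const_mul
      (weightConst p β)
    rw [mul_zero] at this
    exact this.eventually (gt_mem_nhds hε)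
  -- Each exceptional `ν` is the image of an exceptional `k` for one of the finitely many `β' ≤ β`.
  refine (Set.finite_iUnion fun b : Finset.Iic β =>
    (hfin b.1 (Finset.mem_Iic.1 b.2)).image fun k i => ∑ s, k ⟨i, s⟩ + b.1 i).subset fun ν hν => ?_
  obtain ⟨β', h, k, hk, hle⟩ := exists_weight_mul_mahlerCoeff_le β g hg q ν
  exact Set.mem_iUnion.2 ⟨⟨β', Finset.mem_Iic.2 h⟩, k, fun hlt => hν (hle.trans_lt hlt), funext hk⟩

theorem weight_mul_mahlerCoeff_le {f : zpCube p ι → E} (β : ι → ℕ)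
    (g : ∀ β' ≤ β, C(extDom (zpCube p ι) β', E)) (hg : ∀ β' h, IsDiffExt f β' (g β' h))
    (q : ContUltraSeminorm ℚ_[p] E) {D : ℝ} (hD : ∀ β' h x, q.1 (g β' h x) ≤ D) (ν : ι → ℕ) :
    (monomialWeight β ν : ℝ) * q.1 (mahlerCoeff f ν) ≤ weightConst p β * D := by
  obtain ⟨β', h, k, -, hle⟩ := exists_weight_mul_mahlerCoeff_le β g hg q ν
  exact hle.trans (mul_le_mul_of_nonneg_left
    (seminorm_newtonCoeff_le q.2.2 (fun _ => hD _ _ _) k) (weightConst_nonneg p β))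

end CoefficientEstimates

/-! ### Uniqueness of continuous extensions -/

section Density

/-- Hall's marriage theorem, applied to finite subsets with as many elements as there are indices.
-/
lemma exists_injective_mem_of_infinite {κ α : Type*} [Fintype κ] {A : κ → Set α}
    (hA : ∀ j, (A j).Infinite) : ∃ y : κ → α, Function.Injective y ∧ ∀ j, y j ∈ A j := by
  classical
  choose t htA ht using fun j => (hA j).exists_subset_card_eq (Fintype.card κ)
  obtain ⟨y, hy, hyt⟩ := (Finset.all_card_le_biUnion_card_iff_exists_injective t).1 fun s => by
    rcases s.eq_empty_or_nonempty with rfl | ⟨j, hj⟩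
    · simp
    · calc s.card ≤ Fintype.card κ := s.card_le_univ
        _ = (t j).card := (ht j).symm
        _ ≤ _ := Finset.card_le_card (Finset.subset_biUnion_of_mem t hj)
  exact ⟨y, hy, fun j => htA j (hyt j)⟩

variable {ι K : Type*} [Fintype ι] [DecidableEq ι] [Field K] [TopologicalSpace K] [T1Space K]

lemma IsCartesian.dense_diffDom {V : Set (ι → K)} (hV : IsCartesian V) (β : ι → ℕ) :
    Dense (diffDom V β) := by
  obtain ⟨S, hS, rfl⟩ := hV
  intro x
  have hxS : ∀ i j, x.1 i j ∈ S i := fun i j => by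
    simpa using x.2 (Function.update (fun _ => 0) i j) i (Set.mem_univ i)
  rw [mem_closure_iff_nhds]
  intro s hs
  rw [nhds_subtype_eq_comap] at hs
  obtain ⟨t, ht, hts⟩ := hs
  rw [nhds_pi, Filter.mem_pi] at ht
  obtain ⟨I, -, u, hu, hut⟩ := ht
  have h1 : ∀ i, ∃ y : Fin (β i + 1) → K,
      Function.Injective y ∧ (∀ j, y j ∈ S i) ∧ y ∈ u i := by
    intro i
    have hui := hu i
    rw [nhds_pi, Filter.mem_pi] at hui
    obtain ⟨J, -, v, hv, hvu⟩ := hui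
    obtain ⟨y, hy, hyv⟩ := exists_injective_mem_of_infinite (A := fun j => v j ∩ S i) fun j =>
      Set.Infinite.of_accPt ((hS i _ (hxS i j)).nhds_inter (hv j))
    exact ⟨y, hy, fun j => (hyv j).2, hvu fun j _ => (hyv j).1⟩
  choose y hy hyS hyu using h1
  exact ⟨⟨y, fun j i _ => hyS i (j i)⟩, hts (hut fun i _ => hyu i), hy⟩

lemma IsDiffExt.unique {E : Type*} [AddCommGroup E] [Module K E] [TopologicalSpace E] [T2Space E]
    {V : Set (ι → K)} (hV : IsCartesian V) {f : V → E} {β : ι → ℕ} {g h : C(extDom V β, E)}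
    (hg : IsDiffExt f β g) (hh : IsDiffExt f β h) : g = h :=
  DFunLike.coe_injective (g.continuous.ext_on (hV.dense_diffDom β) h.continuous fun x hx =>
    (hg ⟨x, hx⟩).trans (hh ⟨x, hx⟩).symm)

lemma IsDiffExt.sub {E : Type*} [AddCommGroup E] [Module K E] [TopologicalSpace E]
    [IsTopologicalAddGroup E] {V : Set (ι → K)} {f₁ f₂ : V → E} {β : ι → ℕ}
    {g₁ g₂ : C(extDom V β, E)} (h₁ : IsDiffExt f₁ β g₁) (h₂ : IsDiffExt f₂ β g₂) :
    IsDiffExt (f₁ - f₂) β (g₁ - g₂) := fun x => by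
  rw [ContinuousMap.sub_apply, h₁ x, h₂ x]
  simp only [diffQuot, Pi.sub_apply, smul_sub, Finset.sum_sub_distrib]

lemma diffQuot_zero_index {E : Type*} [AddCommGroup E] [Module K E] {V : Set (ι → K)}
    (f : V → E) (x : diffDom V 0) : diffQuot f 0 x = f ⟨fun i => x.1.1 i 0, x.1.2 fun _ => 0⟩ := by
  rw [diffQuot, Fintype.sum_eq_single fun _ => 0]
  · rw [Finset.prod_eq_one, one_smul]
    intro i _
    refine Finset.prod_eq_one fun k hk => ?_
    exact absurd (Subsingleton.elim (α := Fin 1) k 0) (Finset.ne_of_mem_erase hk)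
  · intro j hj
    exact absurd (funext fun i => Subsingleton.elim (α := Fin 1) (j i) 0) hj

lemma IsCAlpha.continuous {E : Type*} [AddCommGroup E] [Module K E] [TopologicalSpace E]
    {U : Set (ι → K)} (hU : IsOpenCartesianIn U U) {α : ι → ℕ∞} {f : U → E}
    (hf : IsCAlpha U α f) : Continuous f := by
  obtain ⟨g, hg⟩ := hf U hU 0 fun i => by simp
  let e : U → extDom U 0 := fun x => ⟨fun i _ => x.1 i, fun _ => x.2⟩
  have he' : Continuous fun (x : U) (i : ι) (_ : Fin ((0 : ι → ℕ) i + 1)) => x.1 i :=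
    continuous_pi fun i => continuous_pi fun _ => (continuous_apply i).comp continuous_subtype_val
  have he : Continuous e := he'.subtype_mk _
  have hfe : f = g ∘ e := by
    funext x
    have hx : e x ∈ diffDom U 0 := fun i a b _ => Subsingleton.elim (α := Fin 1) a b
    exact ((hg ⟨e x, hx⟩).trans (diffQuot_zero_index _ _)).symm
  rw [hfe]
  exact g.continuous.comp he

end Density

/-! ### Characterization of `C^β`-maps for finite multi-indices -/

section CAlpha

variable {p : ℕ} [Fact p.Prime] {ι : Type*} [Fintype ι] [DecidableEq ι]

lemma isOpenCartesianIn_zpCube (p : ℕ) [Fact p.Prime] (ι : Type*) [Fintype ι] [DecidableEq ι] :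
    IsOpenCartesianIn (zpCube p ι) (zpCube p ι) := by
  refine ⟨Subset.rfl, by simp, fun _ => Metric.closedBall 0 1, fun _ => ?_, ?_⟩
  · exact (IsUltrametricDist.isOpen_closedBall _ one_ne_zero).preperfect
  · ext x; simp [zpCube, Set.mem_pi]

variable {E : Type*} [AddCommGroup E] [Module ℚ_[p] E] [UniformSpace E] [IsUniformAddGroup E]
  [ContinuousSMul ℚ_[p] E] [T2Space E]

lemma IsCAlpha.tendsto_weight {f : zpCube p ι → E} {β : ι → ℕ}
    (hf : IsCAlpha (zpCube p ι) (fun i => (β i : ℕ∞)) f) (q : ContUltraSeminorm ℚ_[p] E) :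
    Tendsto (fun ν => (monomialWeight β ν : ℝ) * q.1 (mahlerCoeff f ν)) cofinite (𝓝 0) :=
  tendsto_weight_mul_mahlerCoeff β (fun β' h =>
    hf _ (isOpenCartesianIn_zpCube p ι) β' fun i => Nat.cast_le.2 (h i)) q

variable (hE : IsUltraLocallyConvex ℚ_[p] E)
  (hseq : ∀ u : ℕ → E, CauchySeq u → ∃ x, Tendsto u atTop (𝓝 x))
include hE hseq

lemma isDiffExt_mahlerSum {b : (ι → ℕ) → E} {β : ι → ℕ}
    (hb0 : ∀ q : ContUltraSeminorm ℚ_[p] E,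
      Tendsto (fun ν => (monomialWeight 0 ν : ℝ) * q.1 (b ν)) cofinite (𝓝 0))
    (hb : ∀ q : ContUltraSeminorm ℚ_[p] E,
      Tendsto (fun ν => (monomialWeight β ν : ℝ) * q.1 (b ν)) cofinite (𝓝 0))
    {V : Set (ι → ℚ_[p])} (hV : V ⊆ zpCube p ι) :
    IsDiffExt (mahlerSum b ∘ Set.inclusion hV) β
      ⟨fun x => ddSum b β (intOfExt hV β x),
        (continuous_ddSum hE hseq hb).comp (continuous_intOfExt hV β)⟩ :=
  fun x => (diffQuot_mahlerSum hE hseq hb0 hV β x).symm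

lemma isCAlpha_mahlerSum {b : (ι → ℕ) → E} {β : ι → ℕ}
    (hb : ∀ β' ≤ β, ∀ q : ContUltraSeminorm ℚ_[p] E,
      Tendsto (fun ν => (monomialWeight β' ν : ℝ) * q.1 (b ν)) cofinite (𝓝 0)) :
    IsCAlpha (zpCube p ι) (fun i => (β i : ℕ∞)) (mahlerSum (p := p) b) := fun _ hV β' hβ' =>
  ⟨_, isDiffExt_mahlerSum hE hseq (hb 0 fun _ => Nat.zero_le _)
    (hb β' fun i => Nat.cast_le.1 (hβ' i)) hV.1⟩

lemma isCAlpha_of_tendsto {f : zpCube p ι → E} (hf : Continuous f) {β : ι → ℕ}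
    (hb : ∀ β' ≤ β, ∀ q : ContUltraSeminorm ℚ_[p] E,
      Tendsto (fun ν => (monomialWeight β' ν : ℝ) * q.1 (mahlerCoeff f ν)) cofinite (𝓝 0)) :
    IsCAlpha (zpCube p ι) (fun i => (β i : ℕ∞)) f := by
  rw [← mahlerSum_mahlerCoeff hE hseq hf (hb 0 fun _ => Nat.zero_le _)]
  exact isCAlpha_mahlerSum hE hseq hb

lemma seminorm_ddSum_sub_le {b b' : (ι → ℕ) → E} {β : ι → ℕ}
    (hb : ∀ q : ContUltraSeminorm ℚ_[p] E,
      Tendsto (fun ν => (monomialWeight β ν : ℝ) * q.1 (b ν)) cofinite (𝓝 0))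
    (hb' : ∀ q : ContUltraSeminorm ℚ_[p] E,
      Tendsto (fun ν => (monomialWeight β ν : ℝ) * q.1 (b' ν)) cofinite (𝓝 0))
    (x : ∀ i, Fin (β i + 1) → ℤ_[p]) (q : ContUltraSeminorm ℚ_[p] E) {C : ℝ} (hC : 0 ≤ C)
    (h : ∀ ν, (monomialWeight β ν : ℝ) * q.1 (b ν - b' ν) ≤ C) :
    q.1 (ddSum b β x - ddSum b' β x) ≤ C := by
  refine q.hasSum_le ((summable_smul hE hseq (fun ν => norm_ddProd_le β ν x) hb).hasSum.sub
    (summable_smul hE hseq (fun ν => norm_ddProd_le β ν x) hb').hasSum) hC fun ν => ?_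
  rw [← smul_sub, map_smul_eq_mul]
  exact (mul_le_mul_of_nonneg_right (norm_ddProd_le β ν x) (apply_nonneg _ _)).trans (h ν)

end CAlpha

/-! ### Comparison of monomial weights -/

section Weights

lemma comap_sum_atTop_eq_cofinite {κ : Type*} [Fintype κ] :
    comap (fun ν : κ → ℕ => ∑ i, ν i) atTop = cofinite := by
  classical
  refine le_antisymm ?_ ?_
  · rw [← Nat.cofinite_eq_atTop]
    intro s hs
    obtain ⟨N, hN⟩ : ∃ N : ℕ, ∀ ν ∉ s, ∑ i, ν i ≤ N := by
      obtain ⟨N, hN⟩ := ((hs : sᶜ.Finite).image fun ν : κ → ℕ => ∑ i, ν i).bddAbove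
      exact ⟨N, fun ν hν => hN ⟨ν, hν, rfl⟩⟩
    rw [Nat.cofinite_eq_atTop]
    refine ⟨Set.Ioi N, Ioi_mem_atTop N, fun ν hν => ?_⟩
    by_contra h
    exact absurd (hN ν h) (not_le.2 hν)
  · rw [← map_le_iff_le_comap]
    refine tendsto_atTop.2 fun N => ?_
    refine Set.Finite.subset (Finset.Iic fun _ : κ => N).finite_toSet fun ν hν => ?_
    have hν : ∑ i, ν i < N := not_le.1 hν
    exact Finset.mem_coe.2 (Finset.mem_Iic.2 fun i =>
      (Finset.single_le_sum (fun _ _ => Nat.zero_le _) (Finset.mem_univ i)).trans hν.le)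

/-- All exponents are moved to an index at which `ν` is largest. -/
lemma exists_single_prod_pow_le {κ : Type*} [Fintype κ] [DecidableEq κ] (β ν : κ → ℕ) :
    ∃ c : κ → ℕ, ∑ k, c k = ∑ k, β k ∧ (∀ k k', c k ≠ 0 → c k' ≠ 0 → k = k') ∧
      ∏ k, ν k ^ β k ≤ ∏ k, ν k ^ c k := by
  rcases isEmpty_or_nonempty κ with h | h
  · exact ⟨β, rfl, fun k => h.elim k, le_rfl⟩
  obtain ⟨k, hk⟩ := Finite.exists_max ν
  refine ⟨Pi.single k (∑ k, β k), by simp, fun a b ha hb => ?_, ?_⟩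
  · have key : ∀ a, (Pi.single k (∑ k, β k) : κ → ℕ) a ≠ 0 → a = k := fun a ha => by
      by_contra h
      exact ha (Pi.single_eq_of_ne h _)
    rw [key a ha, key b hb]
  · calc ∏ i, ν i ^ β i ≤ ∏ i, ν k ^ β i :=
          Finset.prod_le_prod' fun i _ => Nat.pow_le_pow_left (hk i) _
      _ = ν k ^ ∑ i, β i := Finset.prod_pow_eq_pow_sum _ _ _
      _ = _ := by
        rw [Finset.prod_eq_single k (fun b _ hb => by rw [Pi.single_eq_of_ne hb, pow_zero])
          fun h => absurd (Finset.mem_univ k) h, Pi.single_eq_same]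

variable {ℓ : ℕ} {n : Fin ℓ → ℕ} {α : Fin ℓ → ℕ∞}

lemma zero_mem_blockIndices : (0 : (Σ j, Fin (n j)) → ℕ) ∈ blockIndices n α := by
  simp [blockIndices]

lemma mem_blockIndices_of_le {β β' : (Σ j, Fin (n j)) → ℕ} (hβ : β ∈ blockIndices n α)
    (h : β' ≤ β) : β' ∈ blockIndices n α := fun j =>
  (Nat.cast_le.2 (Finset.sum_le_sum fun _ _ => h _)).trans (hβ j)

/-- The dominating `β'` depends on `ν`, but its entries are at most `|β|`, so a finite set of
candidates serves all `ν`. -/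
lemma exists_finset_sparseBlockIndices {β : (Σ j, Fin (n j)) → ℕ} (hβ : β ∈ blockIndices n α) :
    ∃ S : Finset ((Σ j, Fin (n j)) → ℕ), ↑S ⊆ sparseBlockIndices n α ∧
      ∀ ν, ∃ β' ∈ S, monomialWeight β ν ≤ monomialWeight β' ν := by
  classical
  let B : (Σ j, Fin (n j)) → ℕ := fun _ => ∑ i, β i
  refine ⟨(Finset.Iic B).filter (· ∈ sparseBlockIndices n α), by
    intro β' h; exact (Finset.mem_filter.1 h).2, fun ν => ?_⟩
  choose c hc hc1 hc2 using fun j =>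
    exists_single_prod_pow_le (fun k => β ⟨j, k⟩) (fun k => ν ⟨j, k⟩)
  refine ⟨fun i => c i.1 i.2, Finset.mem_filter.2 ⟨Finset.mem_Iic.2 fun i => ?_, fun j => ?_, ?_⟩, ?_⟩
  · calc c i.1 i.2 ≤ ∑ k, c i.1 k :=
          Finset.single_le_sum (f := c i.1) (fun _ _ => Nat.zero_le _) (Finset.mem_univ i.2)
      _ = ∑ k, β ⟨i.1, k⟩ := hc _
      _ ≤ ∑ j, ∑ k, β ⟨j, k⟩ := Finset.single_le_sum (f := fun j => ∑ k, β ⟨j, k⟩)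
          (fun _ _ => Nat.zero_le _) (Finset.mem_univ i.1)
      _ = B i := (Fintype.sum_sigma _).symm
  · simpa only [hc] using hβ j
  · exact fun j k k' => hc1 j k k'
  · have h : ∏ i, ν i ^ β i ≤ ∏ i, ν i ^ c i.1 i.2 := by
      rw [Fintype.prod_sigma, Fintype.prod_sigma]
      exact Finset.prod_le_prod' fun j _ => hc2 j
    simp only [monomialWeight]
    exact_mod_cast h

lemma tendsto_of_forall_sparse {p : ℕ} [Fact p.Prime] {E : Type*} [AddCommGroup E]
    [Module ℚ_[p] E] [TopologicalSpace E] {b : ((Σ j, Fin (n j)) → ℕ) → E}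
    {q : ContUltraSeminorm ℚ_[p] E}
    (hb : ∀ β ∈ sparseBlockIndices n α,
      Tendsto (fun ν => (monomialWeight β ν : ℝ) * q.1 (b ν)) cofinite (𝓝 0))
    {β : (Σ j, Fin (n j)) → ℕ} (hβ : β ∈ blockIndices n α) :
    Tendsto (fun ν => (monomialWeight β ν : ℝ) * q.1 (b ν)) cofinite (𝓝 0) := by
  obtain ⟨S, hS, hle⟩ := exists_finset_sparseBlockIndices hβ
  have h := tendsto_finsetSum S fun β' hβ' => hb β' (hS hβ')
  rw [Finset.sum_const_zero] at h
  refine squeeze_zero (fun ν => by positivity) (fun ν => ?_) h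
  obtain ⟨β', hβ', hw⟩ := hle ν
  calc (monomialWeight β ν : ℝ) * q.1 (b ν) ≤ (monomialWeight β' ν : ℝ) * q.1 (b ν) :=
        mul_le_mul_of_nonneg_right (NNReal.coe_le_coe.2 hw) (apply_nonneg _ _)
    _ ≤ _ := Finset.single_le_sum (f := fun β' => (monomialWeight β' ν : ℝ) * q.1 (b ν))
        (fun _ _ => by positivity) hβ'

end Weights

/-! ### The isomorphism between `C^α`-maps and weighted null families -/

section Isomorphism

lemma Seminorm.setOf_sub_lt_mem_nhds {K F : Type*} [NormedField K] [AddCommGroup F] [Module K F]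
    (s : Seminorm K F) (x₀ : F) {ε : ℝ} (hε : 0 < ε) :
    {x | s (x - x₀) < ε} ∈
      @nhds F s.toSeminormedAddCommGroup.toUniformSpace.toTopologicalSpace x₀ := by
  let _ := s.toSeminormedAddCommGroup
  refine Filter.mem_of_superset (Metric.ball_mem_nhds x₀ hε) fun x hx => ?_
  rw [Metric.mem_ball, dist_eq_norm] at hx
  exact hx

lemma Seminorm.continuous_of_forall_eventually {X K F : Type*} [TopologicalSpace X]
    [NormedField K] [AddCommGroup F] [Module K F] (s : Seminorm K F) {A : X → F}
    (h : ∀ x₀, ∀ ε > 0, ∀ᶠ x in 𝓝 x₀, s (A x - A x₀) < ε) :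
    @Continuous X F _ s.toSeminormedAddCommGroup.toUniformSpace.toTopologicalSpace A := by
  let _ := s.toSeminormedAddCommGroup
  refine continuous_iff_continuousAt.2 fun x₀ => Metric.tendsto_nhds.2 fun ε hε => ?_
  refine (h x₀ ε hε).mono fun x hx => ?_
  rw [dist_eq_norm]
  exact hx

variable {p : ℕ} [Fact p.Prime] {ℓ : ℕ} {n : Fin ℓ → ℕ} {α : Fin ℓ → ℕ∞}
  {E : Type*} [AddCommGroup E] [Module ℚ_[p] E] [UniformSpace E] [IsUniformAddGroup E]
  [ContinuousSMul ℚ_[p] E] [T2Space E]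

lemma isCBlock_iff (hE : IsUltraLocallyConvex ℚ_[p] E)
    (hseq : ∀ u : ℕ → E, CauchySeq u → ∃ x, Tendsto u atTop (𝓝 x))
    {f : zpCube p (Σ j, Fin (n j)) → E} (hf : Continuous f) :
    IsCBlock (zpCube p (Σ j, Fin (n j))) α f ↔
      ∀ β ∈ sparseBlockIndices n α, ∀ q : ContUltraSeminorm ℚ_[p] E,
        Tendsto (fun ν => (monomialWeight β ν : ℝ) * q.1 (mahlerCoeff f ν)) cofinite (𝓝 0) :=
  ⟨fun h β hβ q => (h β hβ.1).tendsto_weight q, fun h _ hβ =>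
    isCAlpha_of_tendsto hE hseq hf fun _ hβ' q =>
      tendsto_of_forall_sparse (fun γ hγ => h γ hγ q) (mem_blockIndices_of_le hβ hβ')⟩

lemma C0Space.tendsto_weight_of_blockIndices
    (b : C0Space ℚ_[p] (monomialWeight '' sparseBlockIndices n α) E)
    {β : (Σ j, Fin (n j)) → ℕ} (hβ : β ∈ blockIndices n α) (q : ContUltraSeminorm ℚ_[p] E) :
    Tendsto (fun ν => (monomialWeight β ν : ℝ) * q.1 (b.1 ν)) cofinite (𝓝 0) :=
  tendsto_of_forall_sparse (fun γ hγ => b.2 _ ⟨γ, hγ, rfl⟩ q) hβ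

lemma CBlockSpace.continuous_coe (f : CBlockSpace (zpCube p (Σ j, Fin (n j))) α E) :
    Continuous f.1 :=
  (f.2 0 zero_mem_blockIndices).continuous (isOpenCartesianIn_zpCube p _)

/-- The linear isomorphism between `C^α`-maps and their families of Mahler coefficients. -/
def mahlerLinearEquiv (hE : IsUltraLocallyConvex ℚ_[p] E)
    (hseq : ∀ u : ℕ → E, CauchySeq u → ∃ x, Tendsto u atTop (𝓝 x)) (n : Fin ℓ → ℕ)
    (α : Fin ℓ → ℕ∞) :
    CBlockSpace (zpCube p (Σ j, Fin (n j))) α E ≃ₗ[ℚ_[p]]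
      C0Space ℚ_[p] (monomialWeight '' sparseBlockIndices n α) E where
  toFun f := ⟨mahlerCoeff f.1, by
    rintro _ ⟨β, hβ, rfl⟩ q
    exact (f.2 β hβ.1).tendsto_weight q⟩
  invFun b := ⟨mahlerSum b.1, fun _ hβ => isCAlpha_mahlerSum hE hseq fun _ hβ' q =>
    b.tendsto_weight_of_blockIndices (mem_blockIndices_of_le hβ hβ') q⟩
  left_inv f := Subtype.ext (mahlerSum_mahlerCoeff hE hseq f.continuous_coe fun q =>
    (f.2 0 zero_mem_blockIndices).tendsto_weight (β := 0) q)
  right_inv b := Subtype.ext (mahlerCoeff_mahlerSum b.1)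
  map_add' f g := Subtype.ext (funext fun ν => by
    change mahlerCoeff (f.1 + g.1) ν = mahlerCoeff f.1 ν + mahlerCoeff g.1 ν
    simp only [mahlerCoeff, Pi.add_apply, smul_add, Finset.sum_add_distrib])
  map_smul' c f := Subtype.ext (funext fun ν => by
    change mahlerCoeff (c • f.1) ν = c • mahlerCoeff f.1 ν
    simp only [mahlerCoeff, Pi.smul_apply, Finset.smul_sum]
    exact Finset.sum_congr rfl fun _ _ => smul_comm _ _ _)

lemma CAlphaSpace.continuous_ext {ι K F : Type*} [Fintype ι] [DecidableEq ι] [Field K]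
    [TopologicalSpace K] [AddCommGroup F] [Module K F] [TopologicalSpace F]
    [IsTopologicalAddGroup F] [ContinuousSMul K F] {U : Set (ι → K)} {α : ι → ℕ∞}
    (V : Set (ι → K)) (hV : IsOpenCartesianIn V U) (β : ι → ℕ) (hβ : ∀ i, (β i : ℕ∞) ≤ α i) :
    Continuous (CAlphaSpace.ext V hV β hβ : CAlphaSpace U α F → C(extDom V β, F)) := by
  refine continuous_iff_le_induced.2 ?_
  exact (iInf_le _ V).trans ((iInf_le _ hV).trans ((iInf_le _ β).trans (iInf_le _ hβ)))

lemma CBlockSpace.continuous_incl {K F : Type*} [Field K] [TopologicalSpace K] [AddCommGroup F]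
    [Module K F] [TopologicalSpace F] [IsTopologicalAddGroup F] [ContinuousSMul K F]
    {U : Set ((Σ j, Fin (n j)) → K)} {β : (Σ j, Fin (n j)) → ℕ} (hβ : β ∈ blockIndices n α) :
    Continuous (CBlockSpace.incl β hβ : CBlockSpace U α F → _) := by
  refine continuous_iff_le_induced.2 ?_
  exact (iInf_le _ β).trans (iInf_le _ hβ)

lemma C0Space.eventually_seminorm_sub_lt {X K F : Type*} [NormedField K] {W : Set (X → ℝ≥0)}
    [AddCommGroup F] [Module K F] [TopologicalSpace F] (w : W) (q : ContUltraSeminorm K F)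
    (b₀ : C0Space K W F) {ε : ℝ} (hε : 0 < ε) :
    ∀ᶠ b in 𝓝 b₀, C0Space.seminorm w q (b - b₀) < ε := by
  have hle : (inferInstance : TopologicalSpace (C0Space K W F)) ≤
      (C0Space.seminorm w q).toSeminormedAddCommGroup.toUniformSpace.toTopologicalSpace :=
    (iInf_le _ w).trans (iInf_le _ q)
  exact nhds_mono hle ((C0Space.seminorm w q).setOf_sub_lt_mem_nhds b₀ hε)

lemma continuous_mahlerLinearEquiv (hE : IsUltraLocallyConvex ℚ_[p] E)
    (hseq : ∀ u : ℕ → E, CauchySeq u → ∃ x, Tendsto u atTop (𝓝 x)) :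
    Continuous (mahlerLinearEquiv hE hseq n α) := by
  refine continuous_iInf_rng.2 fun w => continuous_iInf_rng.2 fun q => ?_
  obtain ⟨_, β, hβ, rfl⟩ := w
  refine Seminorm.continuous_of_forall_eventually _ fun f₀ ε hε => ?_
  have hU := isOpenCartesianIn_zpCube p (Σ j, Fin (n j))
  have hle : ∀ β' ≤ β, ∀ i, (β' i : ℕ∞) ≤ (β i : ℕ∞) := fun β' h i => Nat.cast_le.2 (h i)
  let g : ∀ β' ≤ β, CBlockSpace (zpCube p (Σ j, Fin (n j))) α E →
      C(extDom (zpCube p (Σ j, Fin (n j))) β', E) :=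
    fun β' h f => CAlphaSpace.ext _ hU β' (hle β' h) (CBlockSpace.incl β hβ.1 f)
  have hg : ∀ β' h f, IsDiffExt f.1 β' (g β' h f) := fun β' h f =>
    CAlphaSpace.isDiffExt_ext _ hU β' (hle β' h) (CBlockSpace.incl β hβ.1 f)
  have hgc : ∀ β' h, Continuous (g β' h) := fun β' h =>
    (CAlphaSpace.continuous_ext _ hU β' (hle β' h)).comp (CBlockSpace.continuous_incl hβ.1)
  obtain ⟨D, hD, hDε⟩ : ∃ D > 0, weightConst p β * D < ε := by
    have hC := weightConst_nonneg p β
    refine ⟨ε / (weightConst p β + 1), by positivity, ?_⟩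
    rw [mul_div_assoc', div_lt_iff₀ (by positivity)]
    nlinarith
  have hev : ∀ᶠ f in 𝓝 f₀, ∀ b : Finset.Iic β, ∀ x,
      q.1 (g b.1 (Finset.mem_Iic.1 b.2) f x - g b.1 (Finset.mem_Iic.1 b.2) f₀ x) < D := by
    refine eventually_all.2 fun b => ?_
    -- Convergence of the extensions over the whole cube is uniform by compactness.
    exact ContinuousMap.tendsto_iff_tendstoUniformly.1 ((hgc b.1 (Finset.mem_Iic.1 b.2)).tendsto f₀)
      _ (seminorm_lt_mem_uniformity q.2.1 hD)
  filter_upwards [hev] with f hf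
  refine lt_of_le_of_lt (Real.iSup_le (fun ν => ?_) ?_) hDε
  · rw [← map_sub]
    exact weight_mul_mahlerCoeff_le (f := f.1 - f₀.1) β (fun β' h => g β' h f - g β' h f₀)
      (fun β' h => (hg β' h f).sub (hg β' h f₀)) q
      (fun β' h x => (hf ⟨β', Finset.mem_Iic.2 h⟩ x).le) ν
  · exact mul_nonneg (weightConst_nonneg p β) hD.le

lemma continuous_mahlerLinearEquiv_symm (hE : IsUltraLocallyConvex ℚ_[p] E)
    (hseq : ∀ u : ℕ → E, CauchySeq u → ∃ x, Tendsto u atTop (𝓝 x)) :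
    Continuous (mahlerLinearEquiv hE hseq n α).symm := by
  refine continuous_iInf_rng.2 fun β => continuous_iInf_rng.2 fun hβ =>
    continuous_induced_rng.2 ?_
  refine continuous_iInf_rng.2 fun V => continuous_iInf_rng.2 fun hV =>
    continuous_iInf_rng.2 fun β' => continuous_iInf_rng.2 fun hβ' => continuous_induced_rng.2 ?_
  have hβ'' : β' ∈ blockIndices n α :=
    mem_blockIndices_of_le hβ fun i => Nat.cast_le.1 (hβ' i)
  -- The chosen extension is identified with the explicit series by uniqueness, `diffDom V β'` being
  -- dense.
  have hext : ∀ b x, CAlphaSpace.ext V hV β' hβ'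
      (CBlockSpace.incl β hβ ((mahlerLinearEquiv hE hseq n α).symm b)) x =
        ddSum b.1 β' (intOfExt hV.1 β' x) := by
    intro b x
    rw [(CAlphaSpace.isDiffExt_ext V hV β' hβ' (CBlockSpace.incl β hβ
      ((mahlerLinearEquiv hE hseq n α).symm b))).unique hV.2.2 (isDiffExt_mahlerSum hE hseq
        (b.tendsto_weight_of_blockIndices zero_mem_blockIndices)
        (b.tendsto_weight_of_blockIndices hβ'') hV.1)]
    rfl
  refine continuous_iff_continuousAt.2 fun b₀ =>
    ContinuousMap.tendsto_iff_forall_isCompact_tendstoUniformlyOn.2 fun C _ u hu => ?_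
  obtain ⟨q, hq⟩ := hE.exists_seminorm_uniformity hu
  obtain ⟨S, hS, hle⟩ := exists_finset_sparseBlockIndices hβ''
  have hev : ∀ᶠ b in 𝓝 b₀, ∀ γ : S, C0Space.seminorm
      (⟨_, γ.1, hS γ.2, rfl⟩ : monomialWeight '' sparseBlockIndices n α) q (b - b₀) < 1 / 2 :=
    eventually_all.2 fun γ => C0Space.eventually_seminorm_sub_lt _ q b₀ (by norm_num)
  filter_upwards [hev] with b hb x _
  refine hq _ _ (lt_of_le_of_lt (b := 1 / 2) ?_ (by norm_num))
  simp only [Function.comp_apply]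
  rw [hext, hext]
  refine seminorm_ddSum_sub_le hE hseq (b.tendsto_weight_of_blockIndices hβ'')
    (b₀.tendsto_weight_of_blockIndices hβ'') _ q (by norm_num) fun ν => ?_
  obtain ⟨γ, hγ, hw⟩ := hle ν
  calc (monomialWeight β' ν : ℝ) * q.1 (b.1 ν - b₀.1 ν)
      ≤ (monomialWeight γ ν : ℝ) * q.1 (b.1 ν - b₀.1 ν) :=
        mul_le_mul_of_nonneg_right (NNReal.coe_le_coe.2 hw) (apply_nonneg _ _)
    _ ≤ C0Space.seminorm (⟨_, γ, hS hγ, rfl⟩ : monomialWeight '' sparseBlockIndices n α) q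
        (b - b₀) := le_ciSup (C0Space.bddAbove
          (⟨_, γ, hS hγ, rfl⟩ : monomialWeight '' sparseBlockIndices n α) q (b - b₀)) ν
    _ ≤ 1 / 2 := (hb ⟨γ, hγ⟩).le

end Isomorphism

/-! ### Maps of class `C^r` -/

section Cr

variable {p : ℕ} [Fact p.Prime] {ι : Type*} [Fintype ι] [DecidableEq ι]
  {E : Type*} [AddCommGroup E] [Module ℚ_[p] E] [UniformSpace E] [IsUniformAddGroup E]
  [ContinuousSMul ℚ_[p] E] [T2Space E]

/-- The point `ν = 0` is excluded because there the weight for `β = 0` is 1 while the right side is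
0 for `r > 0`. -/
lemma monomialWeight_le_sum_pow {β ν : ι → ℕ} {r : ℕ} (hβ : ∑ i, β i ≤ r) (hν : ν ≠ 0) :
    (monomialWeight β ν : ℝ) ≤ ((∑ i, ν i : ℕ) : ℝ) ^ r := by
  have h1 : 1 ≤ ∑ i, ν i := by
    obtain ⟨i, hi⟩ := Function.ne_iff.1 hν
    exact (Nat.one_le_iff_ne_zero.2 hi).trans
      (Finset.single_le_sum (fun _ _ => Nat.zero_le _) (Finset.mem_univ i))
  have h : ∏ i, ν i ^ β i ≤ (∑ i, ν i) ^ r := by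
    calc ∏ i, ν i ^ β i ≤ ∏ i, (∑ k, ν k) ^ β i := Finset.prod_le_prod' fun i _ =>
          Nat.pow_le_pow_left (Finset.single_le_sum (fun _ _ => Nat.zero_le _) (Finset.mem_univ i)) _
      _ = (∑ k, ν k) ^ ∑ i, β i := Finset.prod_pow_eq_pow_sum _ _ _
      _ ≤ _ := Nat.pow_le_pow_right h1 hβ
  simp only [monomialWeight]
  push_cast
  exact_mod_cast h

lemma sum_pow_le_sum_monomialWeight [Nonempty ι] (ν : ι → ℕ) (r : ℕ) :
    ((∑ i, ν i : ℕ) : ℝ) ^ r ≤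
      (Fintype.card ι : ℝ) ^ r * ∑ i, (monomialWeight (Pi.single i r) ν : ℝ) := by
  obtain ⟨k, hk⟩ := Finite.exists_max ν
  have h1 : ∑ i, ν i ≤ Fintype.card ι * ν k := by
    simpa using Finset.sum_le_card_nsmul Finset.univ ν (ν k) fun i _ => hk i
  have h2 : (monomialWeight (Pi.single k r) ν : ℝ) = (ν k : ℝ) ^ r := by
    rw [monomialWeight, Finset.prod_eq_single k (fun b _ hb => by
      rw [Pi.single_eq_of_ne hb, pow_zero]) fun h => absurd (Finset.mem_univ k) h, Pi.single_eq_same]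
    simp
  calc ((∑ i, ν i : ℕ) : ℝ) ^ r ≤ ((Fintype.card ι * ν k : ℕ) : ℝ) ^ r := by gcongr
    _ = (Fintype.card ι : ℝ) ^ r * (monomialWeight (Pi.single k r) ν : ℝ) := by
      rw [h2, Nat.cast_mul, mul_pow]
    _ ≤ _ := by
      gcongr
      exact Finset.single_le_sum (f := fun i => (monomialWeight (Pi.single i r) ν : ℝ))
        (fun _ _ => by positivity) (Finset.mem_univ k)

lemma isCr_iff (hE : IsUltraLocallyConvex ℚ_[p] E)
    (hseq : ∀ u : ℕ → E, CauchySeq u → ∃ x, Tendsto u atTop (𝓝 x)) (r : ℕ) {f : zpCube p ι → E}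
    (hf : Continuous f) :
    IsCr (zpCube p ι) r f ↔ ∀ q : ContUltraSeminorm ℚ_[p] E,
      Tendsto (fun ν => q.1 (mahlerCoeff f ν) * ((∑ i, ν i : ℕ) : ℝ) ^ r) cofinite (𝓝 0) := by
  constructor
  · intro h q
    -- For empty `ι` there is just one multi-index, so the cofinite filter is trivial; otherwise a
    -- largest coordinate exists.
    rcases isEmpty_or_nonempty ι with hι | hι
    · rw [cofinite_eq_bot]
      exact tendsto_bot
    have h1 : ∀ i, Tendsto (fun ν => (monomialWeight (Pi.single i r) ν : ℝ) *
        q.1 (mahlerCoeff f ν)) cofinite (𝓝 0) := fun i =>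
      (h (Pi.single i r) (by simp)).tendsto_weight q
    have h2 := (tendsto_finsetSum Finset.univ fun i _ => h1 i).const_mul
      ((Fintype.card ι : ℝ) ^ r)
    rw [Finset.sum_const_zero, mul_zero] at h2
    refine squeeze_zero (fun ν => by positivity) (fun ν => ?_) h2
    rw [← Finset.sum_mul, ← mul_assoc, mul_comm]
    exact mul_le_mul_of_nonneg_right (sum_pow_le_sum_monomialWeight ν r) (apply_nonneg _ _)
  · intro h α hα
    refine isCAlpha_of_tendsto hE hseq hf fun β hβ q => ?_
    have hβr : ∑ i, β i ≤ r :=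
      (Finset.sum_le_sum fun i _ => hβ i).trans (Nat.cast_le.1 hα)
    refine squeeze_zero' (Eventually.of_forall fun ν => by positivity) ?_ (h q)
    filter_upwards [(Set.finite_singleton (0 : ι → ℕ)).compl_mem_cofinite] with ν hν
    rw [mul_comm (q.1 _)]
    exact mul_le_mul_of_nonneg_right (monomialWeight_le_sum_pow hβr hν) (apply_nonneg _ _)

end Cr

end

theorem mainTheorem7 (p : ℕ) [Fact p.Prime]
    (E : Type*) [AddCommGroup E] [Module ℚ_[p] E] [UniformSpace E] [IsUniformAddGroup E]
    [ContinuousSMul ℚ_[p] E] [T2Space E]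
    (hE : IsUltraLocallyConvex ℚ_[p] E)
    (hseq : ∀ u : ℕ → E, CauchySeq u → ∃ x, Tendsto u atTop (𝓝 x)) :
    (∀ (ℓ : ℕ) (n : Fin ℓ → ℕ) (α : Fin ℓ → ℕ∞),
      (∀ f : zpCube p (Σ j, Fin (n j)) → E, Continuous f →
        (IsCBlock (zpCube p (Σ j, Fin (n j))) α f ↔
          ∀ β ∈ sparseBlockIndices n α, ∀ q : ContUltraSeminorm ℚ_[p] E,
            Tendsto (fun ν => q.1 (mahlerCoeff f ν) * (monomialWeight β ν : ℝ))
              (comap (fun ν : (Σ j, Fin (n j)) → ℕ => ∑ i, ν i) atTop) (𝓝 0))) ∧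
      (∃ A : CBlockSpace (zpCube p (Σ j, Fin (n j))) α E ≃L[ℚ_[p]]
          C0Space ℚ_[p] (monomialWeight '' sparseBlockIndices n α) E,
        ∀ f, (A f).1 = mahlerCoeff f.1)) ∧
    (∀ (m r : ℕ) (f : zpCube p (Fin m) → E), Continuous f →
      (IsCr (zpCube p (Fin m)) r f ↔
        ∀ q : ContUltraSeminorm ℚ_[p] E,
          Tendsto (fun ν => q.1 (mahlerCoeff f ν) * ((∑ i, ν i : ℕ) : ℝ) ^ r)
            (comap (fun ν : Fin m → ℕ => ∑ i, ν i) atTop) (𝓝 0))) := by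
  refine ⟨fun ℓ n α => ⟨fun f hf => ?_, ⟨⟨mahlerLinearEquiv hE hseq n α,
    continuous_mahlerLinearEquiv hE hseq, continuous_mahlerLinearEquiv_symm hE hseq⟩,
    fun _ => rfl⟩⟩, fun m r f hf => ?_⟩
  · rw [isCBlock_iff hE hseq hf, comap_sum_atTop_eq_cofinite]
    simp only [mul_comm]
  · rw [isCr_iff hE hseq r hf, comap_sum_atTop_eq_cofinite]
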